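/- Let $n\ge r\ge 1$ be integers and write $n=q_1r+r_1$ with $0\le r_1<r$. Let $\mathcal A$ be the algebra of germs at the origin of holomorphic functions on $\mathbb C^n\times\mathbb C^r=\mathbb C^m$, $m=n+r$, with coordinates $a_0,\dots,a_{n-1},b_0,\dots,b_{r-1}$. For an ideal $J\subseteq\mathcal A$ and an integer $k\ge 0$, the Jacobian extension $\Delta_kJ$ is the ideal generated by $J$ and all $k\times k$ minors of the matrix of the first partial derivatives (with respect to the $m$ coordinates) of the elements of $J$; put $\Delta^iJ=\Delta_{m-i+1}J$ for $0\le i\le m$. One says that $\Delta^iJ$ is critical if $\Delta_{m-i+1}J\ne\mathcal A$ and $\Delta_{m-i}J=\mathcal A$; every proper ideal $J$ has exactly one critical extension. For a proper ideal $J$, the Thom–Boardman symbol $TB(J)=(i_1,i_2,\dots)$ is defined by the condition that $\Delta^{i_{1}}J$ is critical for $J$, $\Delta^{i_2}(\Delta^{i_1}J)$ is critical for $\Delta^{i_1}J$, and so on. Let $f=x^n+a_{n-1}x^{n-1}+\cdots+a_0$, $g=x^r+b_{r-1}x^{r-1}+\cdots+b_0$ and $fg=x^{n+r}+c_{n+r-1}x^{n+r-1}+\cdots+c_0$,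 and let $I(\mu_{n,r})\subseteq\mathcal A$ be the ideal generated by $c_0,\dots,c_{n+r-1}$. Define $d_{n-1},\dots,d_0$ recursively by $$d_{n-j}=a_{n-j}-b_{r-j}-\sum_{i+k=j,\ i\ge1,\ 1\le k\le r}d_{n-i}\,b_{r-k}\qquad(1\le j\le n),$$ where the term $b_{r-j}$ is omitted if $j>r$. Put $\psi_i=d_i$ for $0\le i<r$, and $$\psi_{sr+i}=\frac{\partial^s d_{r-1}}{\partial b_0^{\,s-1}\,\partial b_{r-1-i}}\qquad(0\le i<r,\ 1\le s\le q_1-1).$$ Then for every $s=1,\dots,q_1$, $$\underbrace{\Delta^r\cdots\Delta^r}_{s}\,I(\mu_{n,r})=I(\mu_{n,r})+(\psi_0,\dots,\psi_{sr-1}),$$ and each of these $q_1$ successive extensions by $\Delta^r$ is critical. In particular, the first $q_1$ entries of the Thom–Boardman symbol of $I(\mu_{n,r})$ are all equal to $r$. -/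

import Mathlib

open scoped Topology

namespace ThomBoardman

/-! ### The algebra of germs at the origin and its partial derivatives -/

section Germs

variable {ι : Type*} [Fintype ι]

/-- The algebra `𝒜` of germs at the origin of holomorphic functions on `ℂ^ι`, as a subring of
the ring of all germs of functions at the origin. -/
def germRing (ι : Type*) [Fintype ι] : Subring (Filter.Germ (𝓝 (0 : ι → ℂ)) ℂ) where
  carrier := {φ | ∃ f : (ι → ℂ) → ℂ, AnalyticAt ℂ f 0 ∧ (f : Filter.Germ (𝓝 (0 : ι → ℂ)) ℂ) = φ}
  mul_mem' := by
    rintro _ _ ⟨f, hf, rfl⟩ ⟨g, hg, rfl⟩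
    exact ⟨f * g, hf.mul hg, rfl⟩
  one_mem' := ⟨1, analyticAt_const, rfl⟩
  add_mem' := by
    rintro _ _ ⟨f, hf, rfl⟩ ⟨g, hg, rfl⟩
    exact ⟨f + g, hf.add hg, rfl⟩
  zero_mem' := ⟨0, analyticAt_const, rfl⟩
  neg_mem' := by
    rintro _ ⟨f, hf, rfl⟩
    exact ⟨-f, hf.neg, rfl⟩

/-- The germ at the origin of a function that is holomorphic there. -/
noncomputable def germOf (f : (ι → ℂ) → ℂ) (hf : AnalyticAt ℂ f 0) : germRing ι :=
  ⟨(f : Filter.Germ (𝓝 (0 : ι → ℂ)) ℂ), f, hf, rfl⟩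

/-- The coordinate function `x_i` as a germ. -/
noncomputable def coord (i : ι) : germRing ι :=
  germOf (fun x => x i)
    (ContinuousLinearMap.analyticAt (ContinuousLinearMap.proj (R := ℂ) (φ := fun _ : ι => ℂ) i) 0)

variable [DecidableEq ι]

/-- The partial derivative `∂φ/∂x_i` of a germ: the germ of the partial derivative of any
representative. -/
noncomputable def pderiv (i : ι) (φ : germRing ι) : germRing ι :=
  ⟨Filter.Germ.map' (fun (f : (ι → ℂ) → ℂ) (x : ι → ℂ) => fderiv ℂ f x (Pi.single i 1))
      (fun _ _ h => h.fderiv.mono fun x hx => by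
        have hx' := DFunLike.congr_fun hx (Pi.single i 1)
        exact hx') φ.1, by
    obtain ⟨_, f, hf, rfl⟩ := φ
    have h := (ContinuousLinearMap.analyticAt
      (ContinuousLinearMap.apply ℂ ℂ (Pi.single i (1 : ℂ) : ι → ℂ)) (fderiv ℂ f 0)).comp hf.fderiv
    exact ⟨fun x => fderiv ℂ f x (Pi.single i 1), h, rfl⟩⟩

/-! ### Jacobian extensions, critical extensions and the Thom-Boardman symbol -/

/-- The Jacobian extension `Δ_k J`: the ideal spanned by `J` and all minors of order `k` of the
Jacobian matrix of `J`, whose rows are indexed by the elements of `J` and whose columns are indexed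
by the coordinates. (The minors with a repeated row or column are zero.) -/
noncomputable def jacobianExt (k : ℕ) (J : Ideal (germRing ι)) : Ideal (germRing ι) :=
  J ⊔ Ideal.span {φ | ∃ f : Fin k → germRing ι, (∀ u, f u ∈ J) ∧ ∃ c : Fin k → ι,
    φ = (Matrix.of fun u v => pderiv (c v) (f u)).det}

/-- Upper indices: `Δ^i J = Δ_{m-i+1} J`, where `m` is the number of coordinates (`i ≤ m`). -/
noncomputable def upperExt (i : ℕ) (J : Ideal (germRing ι)) : Ideal (germRing ι) :=
  jacobianExt (Fintype.card ι + 1 - i) J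

/-- `Δ^i J = Δ_{m-i+1} J` is critical: `Δ_{m-i+1} J ≠ 𝒜` and `Δ_{m-i} J = 𝒜`. -/
def IsCritical (i : ℕ) (J : Ideal (germRing ι)) : Prop :=
  i ≤ Fintype.card ι ∧ upperExt i J ≠ ⊤ ∧ jacobianExt (Fintype.card ι - i) J = ⊤

/-- The least order `k` such that `Δ_k J` is not the whole algebra. It exists for every proper
ideal `J`, since there are no nonzero minors of order `m + 1`. -/
noncomputable def criticalOrder (J : Ideal (germRing ι)) : ℕ :=
  sInf {k | jacobianExt k J ≠ ⊤}

/-- The critical extension of `J`. -/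
noncomputable def criticalExt (J : Ideal (germRing ι)) : Ideal (germRing ι) :=
  jacobianExt (criticalOrder J) J

/-- The entries of the Thom-Boardman symbol `TB(J) = (i_1, i_2, …)`, with `i_{s+1}` at position `s`:
the upper index `m - k + 1` of the critical extension `Δ_k` of the `s`-th ideal in the sequence of
critical extensions that starts with `J`. -/
noncomputable def thomBoardman (J : Ideal (germRing ι)) (s : ℕ) : ℕ :=
  Fintype.card ι + 1 - criticalOrder (criticalExt^[s] J)

end Germs

/-! ### The polynomial multiplication map -/

section Multiplication

variable (n r : ℕ)

/-- The polynomial `f = x^n + a_{n-1} x^{n-1} + ⋯ + a_0` at a point `(a, b)` of `ℂ^n × ℂ^r`, whose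
coordinates are indexed by `Fin n ⊕ Fin r`. -/
noncomputable def fPoly (p : Fin n ⊕ Fin r → ℂ) : Polynomial ℂ :=
  Polynomial.X ^ n + ∑ i : Fin n, Polynomial.C (p (Sum.inl i)) * Polynomial.X ^ (i : ℕ)

/-- The polynomial `g = x^r + b_{r-1} x^{r-1} + ⋯ + b_0` at a point `(a, b)`. -/
noncomputable def gPoly (p : Fin n ⊕ Fin r → ℂ) : Polynomial ℂ :=
  Polynomial.X ^ r + ∑ j : Fin r, Polynomial.C (p (Sum.inr j)) * Polynomial.X ^ (j : ℕ)

/-- The multiplication map `μ_{n,r} : ℂ^n × ℂ^r → ℂ^{n+r}`, with components the non-leading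
coefficients `c_0, …, c_{n+r-1}` of `h = f g`. -/
noncomputable def mulMap (p : Fin n ⊕ Fin r → ℂ) (j : Fin (n + r)) : ℂ :=
  (fPoly n r p * gPoly n r p).coeff j

theorem analyticAt_mulMap (j : Fin (n + r)) : AnalyticAt ℂ (fun p => mulMap n r p j) 0 := by
  have hc : ∀ i : Fin n ⊕ Fin r, AnalyticAt ℂ (fun p : Fin n ⊕ Fin r → ℂ => p i) 0 := fun i =>
    ContinuousLinearMap.analyticAt
      (ContinuousLinearMap.proj (R := ℂ) (φ := fun _ : Fin n ⊕ Fin r => ℂ) i) 0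
  have hf : ∀ k, AnalyticAt ℂ (fun p => (fPoly n r p).coeff k) 0 := by
    intro k
    simp only [fPoly, Polynomial.coeff_add, Polynomial.finsetSum_coeff, Polynomial.coeff_C_mul]
    exact analyticAt_const.add (Finset.analyticAt_fun_sum _ fun i _ => (hc _).mul analyticAt_const)
  have hg : ∀ k, AnalyticAt ℂ (fun p => (gPoly n r p).coeff k) 0 := by
    intro k
    simp only [gPoly, Polynomial.coeff_add, Polynomial.finsetSum_coeff, Polynomial.coeff_C_mul]
    exact analyticAt_const.add (Finset.analyticAt_fun_sum _ fun i _ => (hc _).mul analyticAt_const)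
  simp only [mulMap, Polynomial.coeff_mul]
  exact Finset.analyticAt_fun_sum _ fun x _ => (hf _).mul (hg _)

/-- The ideal `I(μ_{n,r})` generated by the germs of the components of `μ_{n,r}`. -/
noncomputable def mulIdeal : Ideal (germRing (Fin n ⊕ Fin r)) :=
  Ideal.span (Set.range fun j : Fin (n + r) =>
    germOf (fun p => mulMap n r p j) (analyticAt_mulMap n r j))

/-- The coordinate germ `a_i` (`0 ≤ i < n`). -/
noncomputable def aGerm (i : ℕ) : germRing (Fin n ⊕ Fin r) :=
  if h : i < n then coord (Sum.inl ⟨i, h⟩) else 0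

/-- The coordinate germ `b_j` (`0 ≤ j < r`). -/
noncomputable def bGerm (j : ℕ) : germRing (Fin n ⊕ Fin r) :=
  if h : j < r then coord (Sum.inr ⟨j, h⟩) else 0

/-- `dRev n r j` is `d_{n-j}` for `1 ≤ j ≤ n`, given by the recursion
`d_{n-j} = a_{n-j} - b_{r-j} - ∑_{i+k=j} d_{n-i} b_{r-k}`, with the sum over `i ≥ 1` and
`1 ≤ k ≤ r`, where the term `b_{r-j}` is absent for `j > r`. -/
noncomputable def dRev (j : ℕ) : germRing (Fin n ⊕ Fin r) :=
  aGerm n r (n - j) - (if j ≤ r then bGerm n r (r - j) else 0) -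
    ∑ i : Fin j, if 1 ≤ (i : ℕ) ∧ j - i ≤ r then dRev i * bGerm n r (r - (j - i)) else 0
termination_by j
decreasing_by exact i.2

/-- The polynomial `d_i` for `0 ≤ i < n`. -/
noncomputable def d (i : ℕ) : germRing (Fin n ⊕ Fin r) := dRev n r (n - i)

/-- The partial derivative `∂φ/∂b_j` for `0 ≤ j < r`. -/
noncomputable def pderivB (j : ℕ) (φ : germRing (Fin n ⊕ Fin r)) : germRing (Fin n ⊕ Fin r) :=
  if h : j < r then pderiv (Sum.inr ⟨j, h⟩) φ else 0

/-- The sequence `ψ`: `ψ_i = d_i` for `i < r`, and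
`ψ_{sr+i} = ∂^s d_{r-1} / ∂b_0^{s-1} ∂b_{r-1-i}` for `i < r` and `s ≥ 1`. -/
noncomputable def psi (l : ℕ) : germRing (Fin n ⊕ Fin r) :=
  if l < r then d n r l
  else (pderivB n r 0)^[l / r - 1] (pderivB n r (r - 1 - l % r) (d n r (r - 1)))

end Multiplication

end ThomBoardman

namespace ThomBoardman

open Polynomial

/-! ### Division by a monic polynomial -/

section Division

variable {A : Type*} [CommRing A]

/-! Expand f in base g: q_0 = f and q_t = g q_{t+1} + ρ_t with deg ρ_t < r (`quo`, `digit`).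
Adjoining to I(μ) the coefficients of ρ_0, …, ρ_{s-1} gives the ideal `chain` at s. Two facts
suffice: Δ^r = Δ_{n+1} takes each of these ideals to the next (`jacExt_chain`), and ρ_0, …, ρ_{s-1}
may be replaced by ψ_0, …, ψ_{sr-1} (`chain_eq_sup_psi`).

Upper bound. For a derivation δ put E_t = δq_t + (t+1) q_{t+1} δg (`derQuo`). Then δ(fg) = g E_0 +
ρ_0 δg and E_t = g E_{t+1} + δρ_t + (t+2) ρ_{t+1} δg. So, modulo the next ideal, the gradients of
all generators depend linearly on the n coefficients of E_0, and minors of order n+1 vanish.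

Lower bound. The vector field Y = ∂/∂b_0 - ∑ (q_1)_l ∂/∂a_l has Yg = 1 and Yf = -q_1, hence Y(fg) =
ρ_0, and Yρ_t ≡ -(t+2) ρ_{t+1} modulo ρ_0, …, ρ_t. It kills c_r, …, c_{n+r-1}, whose Jacobian matrix
in the a_i is unitriangular; bordering that matrix shows that Y maps the ideal into its Δ_{n+1}. The
same matrix gives Δ_n = 𝒜. At the origin f = x^n and g = x^r, so ρ_t vanishes there when (t+1)r ≤ n,
which keeps the ideals proper up to s = q_1.

The ψ. Write Res for the coefficient of x⁻¹ at infinity. Then d_i = Res(f x^{r-1-i} / g), and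
differentiating in the b_j gives ψ_{tr+i} = (-1)^t t! Res(f x^{r-1-i} / g^{t+1}). Modulo ρ_0, …,
ρ_{t-1} one has f ≡ g^t q_t, so these residues become Res(ρ_t x^{r-1-i} / g), which determine ρ_t
triangularly. -/

theorem divByMonic_modByMonic_of_degree_lt {G p q : A[X]} (hG : G.Monic)
    (hq : q.degree < G.degree) : (G * p + q) /ₘ G = p ∧ (G * p + q) %ₘ G = q := by
  nontriviality A
  exact div_modByMonic_unique p q hG ⟨add_comm _ _, hq⟩

theorem add_divByMonic {G : A[X]} (hG : G.Monic) (p q : A[X]) :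
    (p + q) /ₘ G = p /ₘ G + q /ₘ G := by
  nontriviality A
  refine (div_modByMonic_unique _ (p %ₘ G + q %ₘ G) hG ⟨?_, ?_⟩).1
  · linear_combination modByMonic_add_div p G + modByMonic_add_div q G
  · exact (degree_add_le _ _).trans_lt
      (max_lt (degree_modByMonic_lt _ hG) (degree_modByMonic_lt _ hG))

theorem smul_divByMonic {G : A[X]} (hG : G.Monic) (c : A) (p : A[X]) :
    (c • p) /ₘ G = c • (p /ₘ G) := by
  nontriviality A
  refine (div_modByMonic_unique _ (c • (p %ₘ G)) hG ⟨?_, ?_⟩).1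
  · rw [mul_smul_comm, ← smul_add, modByMonic_add_div]
  · exact (degree_smul_le _ _).trans_lt (degree_modByMonic_lt _ hG)

/-- The quotient by a monic polynomial, as a linear map. -/
noncomputable def divByMonicHom {G : A[X]} (hG : G.Monic) : A[X] →ₗ[A] A[X] where
  toFun p := p /ₘ G
  map_add' := add_divByMonic hG
  map_smul' := smul_divByMonic hG

/-- The successive quotients of `F` by `G`. -/
noncomputable def quo (G F : A[X]) : ℕ → A[X]
  | 0 => F
  | t + 1 => quo G F t /ₘ G

/-- The digits of the `G`-adic expansion of `F`. -/
noncomputable def digit (G F : A[X]) (t : ℕ) : A[X] := quo G F t %ₘ G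

theorem quo_eq (G F : A[X]) (t : ℕ) : quo G F t = G * quo G F (t + 1) + digit G F t := by
  rw [add_comm]
  exact (modByMonic_add_div _ _).symm

theorem map_quo {B : Type*} [CommRing B] (φ : A →+* B) {G : A[X]} (hG : G.Monic) (F : A[X])
    (t : ℕ) : (quo G F t).map φ = quo (G.map φ) (F.map φ) t := by
  induction t with
  | zero => rfl
  | succ t ih => rw [quo, quo, map_divByMonic φ hG, ih]

theorem map_digit {B : Type*} [CommRing B] (φ : A →+* B) {G : A[X]} (hG : G.Monic) (F : A[X])
    (t : ℕ) : (digit G F t).map φ = digit (G.map φ) (F.map φ) t := by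
  rw [digit, digit, map_modByMonic φ hG, map_quo φ hG]

theorem quo_X_pow [Nontrivial A] {r k t : ℕ} (h : t * r ≤ k) :
    quo (X ^ r : A[X]) (X ^ k) t = X ^ (k - t * r) := by
  induction t with
  | zero => simp [quo]
  | succ t ih =>
    have e : k - t * r = r + (k - (t + 1) * r) := by
      rw [add_mul, one_mul] at *
      omega
    rw [quo, ih (by rw [add_mul] at h; omega), e, pow_add, mul_divByMonic_cancel_left _ (monic_X_pow r)]

theorem digit_X_pow [Nontrivial A] {r k t : ℕ} (h : (t + 1) * r ≤ k) :
    digit (X ^ r : A[X]) (X ^ k) t = 0 := by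
  rw [add_mul, one_mul] at h
  rw [digit, quo_X_pow (by omega), modByMonic_eq_zero_iff_dvd (monic_X_pow r)]
  exact pow_dvd_pow _ (by omega)

/-- A linear functional on polynomials sends polynomials with coefficients in an ideal into that
ideal. -/
theorem functional_mem {K : Ideal A} (T : A[X] →ₗ[A] A) {p : A[X]} (hp : p ∈ K.map C) :
    T p ∈ K := by
  rw [Ideal.mem_map_C_iff] at hp
  rw [p.as_sum_range, map_sum]
  refine K.sum_mem fun i _ => ?_
  rw [← mul_one (p.coeff i), ← smul_eq_mul, ← smul_monomial, map_smul, smul_eq_mul]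
  exact K.mul_mem_right _ (hp i)

theorem linearMap_mem {K : Ideal A} (T : A[X] →ₗ[A] A[X]) {p : A[X]} (hp : p ∈ K.map C) :
    T p ∈ K.map C :=
  Ideal.mem_map_C_iff.2 fun i => functional_mem (lcoeff A i ∘ₗ T) hp

theorem divByMonic_mem {K : Ideal A} {G p q : A[X]} (hG : G.Monic) (hq : q.degree < G.degree)
    (h : G * p + q ∈ K.map C) : p ∈ K.map C := by
  have := linearMap_mem (divByMonicHom hG) h
  rwa [show divByMonicHom hG (G * p + q) = _ from
    (divByMonic_modByMonic_of_degree_lt hG hq).1] at this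

theorem modByMonic_mem {K : Ideal A} {G p q : A[X]} (hG : G.Monic) (hq : q.degree < G.degree)
    (h : G * p + q ∈ K.map C) : q ∈ K.map C := by
  have := linearMap_mem (modByMonicHom G) h
  rwa [show modByMonicHom G (G * p + q) = _ from
    (divByMonic_modByMonic_of_degree_lt hG hq).2] at this

/-- A linear functional of a polynomial is a fixed combination of its coefficients, with the same
weights for every `v`; a uniform bound on the degrees makes the combination finite. -/
theorem functional_family_mem {ι : Type*} [Fintype ι] {Λ : Submodule A (ι → A)}
    (T : A[X] →ₗ[A] A) {P : ι → A[X]} (hP : ∀ k, (fun v => (P v).coeff k) ∈ Λ) :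
    (fun v => T (P v)) ∈ Λ := by
  have h : (fun v => T (P v)) = ∑ k ∈ Finset.range (Finset.univ.sup (fun v => (P v).natDegree) + 1),
      T (monomial k 1) • fun v => (P v).coeff k := by
    funext v
    rw [Finset.sum_apply]
    conv_lhs => rw [(P v).as_sum_range' (Finset.univ.sup (fun v => (P v).natDegree) + 1)
      (Nat.lt_succ_of_le (Finset.le_sup (f := fun v => (P v).natDegree) (Finset.mem_univ v))),
      map_sum]
    refine Finset.sum_congr rfl fun k _ => ?_
    rw [← mul_one ((P v).coeff k), ← smul_eq_mul, ← smul_monomial, map_smul]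
    simp [mul_comm]
  rw [h]
  exact Λ.sum_mem fun k _ => Λ.smul_mem _ (hP k)

end Division

/-! ### Coefficientwise derivations -/

section Derivations

variable {A : Type*} [CommRing A]

/-- The derivation of `A[X]` that acts on the coefficients. -/
noncomputable def coeffDer (D : Derivation ℤ A A) : Derivation ℤ A[X] A[X] :=
  PolynomialModule.equivPolynomialSelf.compDer D.mapCoeffs

theorem coeff_coeffDer (D : Derivation ℤ A A) (p : A[X]) (i : ℕ) :
    (coeffDer D p).coeff i = D (p.coeff i) := rfl

theorem degree_coeffDer_le (D : Derivation ℤ A A) (p : A[X]) :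
    (coeffDer D p).degree ≤ p.degree := by
  refine (degree_le_iff_coeff_zero _ _).2 fun m hm => ?_
  rw [coeff_coeffDer, coeff_eq_zero_of_degree_lt hm, map_zero]

theorem degree_coeffDer_lt [Nontrivial A] (D : Derivation ℤ A A) {p : A[X]} (hp : p.Monic) :
    (coeffDer D p).degree < p.degree := by
  rw [degree_eq_natDegree hp.ne_zero, degree_lt_iff_coeff_zero]
  intro m hm
  rw [coeff_coeffDer]
  rcases hm.eq_or_lt with rfl | h
  · rw [hp.coeff_natDegree, D.map_one_eq_zero]
  · rw [coeff_eq_zero_of_natDegree_lt h, map_zero]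

theorem degree_digit_lt [Nontrivial A] {G : A[X]} (hG : G.Monic) (F : A[X]) (t : ℕ) :
    (digit G F t).degree < G.degree := degree_modByMonic_lt _ hG

/-- The derivative of the quotient `quo G F t`, corrected so that it becomes the `t`-th quotient of
`δ F + quo G F 1 * δ G` modulo the digits of `F`. -/
noncomputable def derQuo (D : Derivation ℤ A A) (G F : A[X]) (t : ℕ) : A[X] :=
  coeffDer D (quo G F t) + (t + 1) * quo G F (t + 1) * coeffDer D G

/-- The factor `t + 1` in `derQuo` is chosen for this: differentiating q_t = g q_{t+1} + ρ_t gives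
an extra q_{t+1} δg, and substituting for q_{t+1} leaves a multiple of g plus digit terms. -/
theorem derQuo_eq (D : Derivation ℤ A A) (G F : A[X]) (t : ℕ) :
    derQuo D G F t = G * derQuo D G F (t + 1) + coeffDer D (digit G F t) +
      (t + 2) * digit G F (t + 1) * coeffDer D G := by
  have h1 : coeffDer D (quo G F t) = G * coeffDer D (quo G F (t + 1)) +
      quo G F (t + 1) * coeffDer D G + coeffDer D (digit G F t) := by
    conv_lhs => rw [quo_eq]
    simp [Derivation.leibniz]
  have h2 := quo_eq G F (t + 1)
  rw [derQuo, derQuo, h1]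
  push_cast
  linear_combination ((t : A[X]) + 2) * coeffDer D G * h2

theorem derQuo_zero (D : Derivation ℤ A A) (G F : A[X]) :
    derQuo D G F 0 = coeffDer D F + quo G F 1 * coeffDer D G := by
  simp [derQuo, quo]

theorem coeffDer_mul_eq (D : Derivation ℤ A A) (G F : A[X]) :
    coeffDer D (F * G) = G * derQuo D G F 0 + digit G F 0 * coeffDer D G := by
  have := quo_eq G F 0
  rw [derQuo_zero, Derivation.leibniz, smul_eq_mul, smul_eq_mul]
  simp only [quo] at this ⊢
  linear_combination coeffDer D G * this

/-- Modulo the digits, `derQuo_eq` is a division by `G` with remainder the derivative of a digit;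
the quotient of a polynomial that vanishes modulo `K` vanishes too. -/
theorem derQuo_mem [Nontrivial A] (D : Derivation ℤ A A) {G F : A[X]} (hG : G.Monic) {K : Ideal A}
    {s : ℕ} (hK : ∀ t ≤ s, digit G F t ∈ K.map C) (h0 : derQuo D G F 0 ∈ K.map C) :
    ∀ t ≤ s, derQuo D G F t ∈ K.map C := by
  intro t
  induction t with
  | zero => exact fun _ => h0
  | succ t ih =>
    intro ht
    refine divByMonic_mem hG ((degree_coeffDer_le D (digit G F t)).trans_lt
      (degree_digit_lt hG F t)) ?_
    have h := derQuo_eq D G F t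
    rw [← sub_eq_iff_eq_add] at h
    rw [← h]
    exact Ideal.sub_mem _ (ih (by omega))
      (Ideal.mul_mem_right _ _ (Ideal.mul_mem_left _ _ (hK _ ht)))

/-- Along a derivation with `δ G = 1` and `δ F = - quo G F 1`, the derivative of the last of the
vanishing digits is a multiple of the next digit. -/
theorem coeffDer_digit_add_mem [Nontrivial A] (D : Derivation ℤ A A) {G F : A[X]} (hG : G.Monic)
    (hG1 : coeffDer D G = 1) (hF : coeffDer D F = - quo G F 1) {K : Ideal A} {s : ℕ}
    (hK : ∀ t ≤ s, digit G F t ∈ K.map C) :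
    coeffDer D (digit G F s) + C ((s : A) + 2) * digit G F (s + 1) ∈ K.map C := by
  have h0 : derQuo D G F 0 ∈ K.map C := by
    rw [derQuo_zero, hG1, hF]
    simp
  have h := derQuo_mem D hG hK h0 s le_rfl
  rw [derQuo_eq, hG1, mul_one, add_assoc] at h
  have e : (C ((s : A) + 2)) = (s : A[X]) + 2 := by
    rw [map_add, map_natCast, map_ofNat]
  rw [e]
  -- Both summands have degree below that of `G`, so their sum is exactly the remainder of the
  -- vanishing `derQuo D G F s`.
  refine modByMonic_mem hG ((degree_add_le _ _).trans_lt (max_lt ?_ ?_)) h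
  · exact (degree_coeffDer_le D _).trans_lt (degree_digit_lt hG F s)
  · rw [← e, ← smul_eq_C_mul]
    exact (degree_smul_le _ _).trans_lt (degree_digit_lt hG F _)

/-- If the coefficients of `δ_v F + quo G F 1 * δ_v G` lie in a module `Λ` that contains all vectors
with entries in `K`, then so do those of the derivatives of the digits. -/
theorem coeff_derQuo_family_mem [Nontrivial A] {ι : Type*} [Fintype ι] {D : ι → Derivation ℤ A A}
    {G F : A[X]} (hG : G.Monic) {K : Ideal A} {Λ : Submodule A (ι → A)}
    (hΛ : ∀ w : ι → A, (∀ v, w v ∈ K) → w ∈ Λ)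
    (h0 : ∀ i, (fun v => (derQuo (D v) G F 0).coeff i) ∈ Λ) {s : ℕ}
    (hK : ∀ t ≤ s, digit G F t ∈ K.map C) :
    ∀ t < s, (∀ i, (fun v => (derQuo (D v) G F (t + 1)).coeff i) ∈ Λ) ∧
      ∀ i, (fun v => D v ((digit G F t).coeff i)) ∈ Λ := by
  have step : ∀ t < s, (∀ i, (fun v => (derQuo (D v) G F t).coeff i) ∈ Λ) →
      (∀ i, (fun v => (derQuo (D v) G F (t + 1)).coeff i) ∈ Λ) ∧
      ∀ i, (fun v => D v ((digit G F t).coeff i)) ∈ Λ := by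
    intro t ht ih
    -- Dropping the digit term, which has entries in `K`, leaves a division by `G`; its quotient and
    -- remainder depend linearly on the dividend.
    have hP : ∀ i, (fun v => (G * derQuo (D v) G F (t + 1) +
        coeffDer (D v) (digit G F t)).coeff i) ∈ Λ := by
      intro i
      have e : (fun v => (G * derQuo (D v) G F (t + 1) + coeffDer (D v) (digit G F t)).coeff i) =
          (fun v => (derQuo (D v) G F t).coeff i) -
          fun v => ((t + 2) * digit G F (t + 1) * coeffDer (D v) G).coeff i := by
        funext v
        rw [Pi.sub_apply, derQuo_eq (D v) G F t, coeff_add _ (_ * _), add_sub_cancel_right]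
      rw [e]
      refine Λ.sub_mem (ih i) (hΛ _ fun v => ?_)
      exact Ideal.mem_map_C_iff.1 (Ideal.mul_mem_right _ _ (Ideal.mul_mem_left _ _ (hK _ ht))) i
    have hdeg : ∀ v, (coeffDer (D v) (digit G F t)).degree < G.degree := fun v =>
      (degree_coeffDer_le _ _).trans_lt (degree_digit_lt hG F t)
    constructor
    · intro i
      have := functional_family_mem (lcoeff A i ∘ₗ divByMonicHom hG) hP
      simpa [divByMonicHom, divByMonic_modByMonic_of_degree_lt hG (hdeg _)] using this
    · intro i
      have := functional_family_mem (lcoeff A i ∘ₗ modByMonicHom G) hP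
      simpa [modByMonicHom, divByMonic_modByMonic_of_degree_lt hG (hdeg _), coeff_coeffDer]
        using this
  intro t
  induction t with
  | zero => exact fun hs => step 0 hs h0
  | succ t ih => exact fun hs => step _ hs (ih (by omega)).1

end Derivations

/-! ### Jacobian minors with respect to a family of derivations -/

section Minors

variable {A : Type*} [CommRing A] {ι : Type*}

/-- The ideal spanned by `J` and the minors of order `k` of the matrix of derivatives of the
elements of `J` along a family of derivations. -/
def jacExt (D : ι → Derivation ℤ A A) (k : ℕ) (J : Ideal A) : Ideal A :=
  J ⊔ Ideal.span {φ | ∃ f : Fin k → A, (∀ u, f u ∈ J) ∧ ∃ c : Fin k → ι,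
    φ = (Matrix.of fun u v => D (c v) (f u)).det}

theorem le_jacExt (D : ι → Derivation ℤ A A) (k : ℕ) (J : Ideal A) : J ≤ jacExt D k J := le_sup_left

theorem det_mem_jacExt (D : ι → Derivation ℤ A A) {k : ℕ} {J : Ideal A} {f : Fin k → A}
    (hf : ∀ u, f u ∈ J) (c : Fin k → ι) :
    (Matrix.of fun u v => D (c v) (f u)).det ∈ jacExt D k J :=
  Ideal.mem_sup_right (Ideal.subset_span ⟨f, hf, c, rfl⟩)

/-- Laplace expansion along the first row. -/
theorem jacExt_succ_le (D : ι → Derivation ℤ A A) (k : ℕ) (J : Ideal A) :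
    jacExt D (k + 1) J ≤ jacExt D k J := by
  refine sup_le le_sup_left (Ideal.span_le.2 ?_)
  rintro _ ⟨f, hf, c, rfl⟩
  rw [SetLike.mem_coe, Matrix.det_succ_row_zero]
  exact Ideal.sum_mem _ fun j _ => Ideal.mul_mem_left _ _
    (det_mem_jacExt D (f := fun u => f u.succ) (fun u => hf _) (fun v => c (j.succAbove v)))

theorem jacExt_antitone (D : ι → Derivation ℤ A A) (J : Ideal A) :
    Antitone fun k => jacExt D k J :=
  antitone_nat_of_succ_le fun k => jacExt_succ_le D k J

/-- A determinant of order `n + 1` whose rows are combinations of `n` vectors modulo `K` lies in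
`K`. -/
theorem det_mem_of_combination {n : ℕ} {K : Ideal A} {M : Matrix (Fin (n + 1)) (Fin (n + 1)) A}
    (α : Fin (n + 1) → Fin n → A) (e : Fin n → Fin (n + 1) → A)
    (h : ∀ u v, M u v - ∑ k, α u k * e k v ∈ K) : M.det ∈ K := by
  rw [← Ideal.Quotient.eq_zero_iff_mem, RingHom.map_det]
  -- The n vectors are padded by zero to a square factorization, whose left factor has a zero
  -- column.
  have hM : (Ideal.Quotient.mk K).mapMatrix M =
      (Ideal.Quotient.mk K).mapMatrix
        ((Matrix.of fun u => Fin.cons 0 (α u)) * Matrix.of (Fin.cons 0 e)) := by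
    ext u v
    rw [RingHom.mapMatrix_apply, RingHom.mapMatrix_apply, Matrix.map_apply, Matrix.map_apply,
      Ideal.Quotient.eq, Matrix.mul_apply, Fin.sum_univ_succ]
    simpa using h u v
  rw [hM, ← RingHom.map_det, Matrix.det_mul,
    Matrix.det_eq_zero_of_column_eq_zero (0 : Fin (n + 1)) (fun i => by simp), zero_mul, map_zero]

/-- It is enough to inspect generators: in D(af) = a Df + f Da the second term already lies in `K`.
-/
theorem jacExt_le_of_combination {n : ℕ} (D : ι → Derivation ℤ A A) {S : Set A} {K : Ideal A}
    (e : Fin n → ι → A) (hSK : Ideal.span S ≤ K)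
    (hS : ∀ f ∈ S, ∃ α : Fin n → A, ∀ v, D v f - ∑ k, α k * e k v ∈ K) :
    jacExt D (n + 1) (Ideal.span S) ≤ K := by
  have hJ : ∀ f ∈ Ideal.span S, ∃ α : Fin n → A, ∀ v, D v f - ∑ k, α k * e k v ∈ K := by
    intro f hf
    refine Submodule.span_induction hS ⟨0, by simp⟩ ?_ ?_ hf
    · rintro f g - - ⟨α, hα⟩ ⟨β, hβ⟩
      refine ⟨α + β, fun v => ?_⟩
      convert K.add_mem (hα v) (hβ v) using 1
      simp only [map_add, Pi.add_apply, add_mul, Finset.sum_add_distrib]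
      ring
    · rintro a f hfm ⟨α, hα⟩
      refine ⟨a • α, fun v => ?_⟩
      convert K.add_mem (K.mul_mem_left a (hα v)) (K.mul_mem_right (D v a) (hSK hfm)) using 1
      simp only [smul_eq_mul, Derivation.leibniz, Pi.smul_apply, mul_assoc, ← Finset.mul_sum]
      ring
  refine sup_le hSK (Ideal.span_le.2 ?_)
  rintro _ ⟨f, hf, c, rfl⟩
  choose α hα using fun u => hJ (f u) (hf u)
  exact det_mem_of_combination α (fun k v => e k (c v)) fun u v => hα u (c v)

/-- If the derivatives of `h` along `col` form a matrix of determinant one, and the vector field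
`X = D w - ∑ q l • D (col l)` maps the `h k` into `J`, then `X` maps `J` into the ideal of minors of
order `n + 1`. -/
theorem derivative_mem_jacExt {n : ℕ} (D : ι → Derivation ℤ A A) {J : Ideal A} {h : Fin n → A}
    (hJ : ∀ k, h k ∈ J) (col : Fin n → ι) (hdet : (Matrix.of fun k l => D (col l) (h k)).det = 1)
    (w : ι) (q : Fin n → A) {Y : Derivation ℤ A A} (hY : ∀ f, Y f = D w f - ∑ l, q l * D (col l) f)
    (hYh : ∀ k, Y (h k) ∈ J) {f : A} (hf : f ∈ J) : Y f ∈ jacExt D (n + 1) J := by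
  let P : Matrix (Fin n) (Fin n) A := Matrix.of fun k l => D (col l) (h k)
  let z : Matrix (Fin 1) (Fin n) A := Matrix.of fun _ l => D (col l) f
  let M : Matrix (Fin n ⊕ Fin 1) (Fin n ⊕ Fin 1) A :=
    Matrix.fromBlocks P (Matrix.of fun k _ => D w (h k)) z (Matrix.of fun _ _ => D w f)
  -- Multiplication on the right by this unipotent matrix is the column operation that turns `D w`
  -- into `Y` in the last column.
  let U : Matrix (Fin n ⊕ Fin 1) (Fin n ⊕ Fin 1) A :=
    Matrix.fromBlocks 1 (Matrix.of fun l _ => - q l) 0 1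
  have hMU : M * U = Matrix.fromBlocks P (Matrix.of fun k _ => Y (h k)) z
      (Matrix.of fun _ _ => Y f) := by
    rw [Matrix.fromBlocks_multiply]
    congr 1
    · simp
    · ext k _
      simp [Matrix.mul_apply, hY, P, mul_comm, neg_add_eq_sub]
    · simp
    · ext k _
      simp [Matrix.mul_apply, hY, z, mul_comm, neg_add_eq_sub]
  have hMmem : M.det ∈ jacExt D (n + 1) J := by
    have e : M.submatrix finSumFinEquiv.symm finSumFinEquiv.symm = Matrix.of fun u v =>
        D (Sum.elim col (fun _ : Fin 1 => w) (finSumFinEquiv.symm v))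
          (Sum.elim h (fun _ : Fin 1 => f) (finSumFinEquiv.symm u)) := by
      ext u v
      rcases hu : finSumFinEquiv.symm u with a | a <;> rcases hv : finSumFinEquiv.symm v with b | b <;>
        simp [hu, hv, M, P, z]
    rw [← Matrix.det_submatrix_equiv_self finSumFinEquiv.symm M, e]
    refine det_mem_jacExt D (fun u => ?_) _
    rcases finSumFinEquiv.symm u with a | a
    · exact hJ a
    · exact hf
  -- Modulo `J` the upper part of the last column vanishes, so the bordered determinant reduces to
  -- `det P * Y f = Y f`.
  have hdiff : M.det - Y f ∈ J := by
    have hU : U.det = 1 := by simp [U]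
    rw [← mul_one M.det, ← hU, ← Matrix.det_mul, hMU, ← Ideal.Quotient.eq, RingHom.map_det,
      RingHom.mapMatrix_apply, Matrix.fromBlocks_map]
    have h0 : (Matrix.of fun (k : Fin n) (_ : Fin 1) => Y (h k)).map (Ideal.Quotient.mk J) = 0 := by
      ext k _
      exact Ideal.Quotient.eq_zero_iff_mem.2 (hYh k)
    rw [h0, Matrix.det_fromBlocks_zero₁₂, ← RingHom.mapMatrix_apply, ← RingHom.map_det, hdet]
    simp
  have := Ideal.sub_mem _ hMmem (le_jacExt D (n + 1) J hdiff)
  rwa [sub_sub_cancel] at this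

end Minors

/-! ### The chain of ideals spanned by the digits -/

section Chain

variable {A : Type*} [CommRing A]

/-- The monic polynomial with lower coefficients `c`. -/
noncomputable def monicOf {k : ℕ} (c : Fin k → A) : A[X] :=
  X ^ k + ∑ i : Fin k, C (c i) * X ^ (i : ℕ)

theorem coeff_monicOf {k : ℕ} (c : Fin k → A) (i : ℕ) :
    (monicOf c).coeff i = if h : i < k then c ⟨i, h⟩ else if i = k then 1 else 0 := by
  simp only [monicOf, coeff_add, coeff_X_pow, finsetSum_coeff, coeff_C_mul]
  by_cases h : i < k
  · rw [dif_pos h, if_neg h.ne, zero_add, Finset.sum_eq_single ⟨i, h⟩]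
    · simp
    · intro j _ hj
      rw [if_neg, mul_zero]
      exact fun h => hj (Fin.ext h.symm)
    · simp
  · rw [dif_neg h, Finset.sum_eq_zero, add_zero]
    intro j _
    rw [if_neg (by omega), mul_zero]

theorem coeff_monicOf_self {k : ℕ} (c : Fin k → A) : (monicOf c).coeff k = 1 := by
  simp [coeff_monicOf]

theorem natDegree_monicOf_le {k : ℕ} (c : Fin k → A) : (monicOf c).natDegree ≤ k := by
  refine natDegree_le_iff_coeff_eq_zero.2 fun i hi => ?_
  rw [coeff_monicOf, dif_neg (by omega), if_neg (by omega)]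

theorem monic_monicOf {k : ℕ} (c : Fin k → A) : (monicOf c).Monic :=
  monic_of_natDegree_le_of_coeff_eq_one k (natDegree_monicOf_le c) (coeff_monicOf_self c)

theorem natDegree_monicOf [Nontrivial A] {k : ℕ} (c : Fin k → A) : (monicOf c).natDegree = k :=
  natDegree_eq_of_le_of_coeff_ne_zero (natDegree_monicOf_le c) (by simp [coeff_monicOf_self])

theorem map_monicOf {B : Type*} [CommRing B] (φ : A →+* B) {k : ℕ} (c : Fin k → A) :
    (monicOf c).map φ = monicOf (φ ∘ c) := by
  simp [monicOf, Polynomial.map_sum]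

theorem coeffDer_monicOf (D : Derivation ℤ A A) {k : ℕ} (c : Fin k → A) :
    coeffDer D (monicOf c) = ∑ i : Fin k, C (D (c i)) * X ^ (i : ℕ) := by
  ext i
  simp only [coeff_coeffDer, coeff_monicOf, finsetSum_coeff, coeff_C_mul, coeff_X_pow]
  by_cases h : i < k
  · rw [dif_pos h, Finset.sum_eq_single ⟨i, h⟩]
    · simp
    · intro j _ hj
      rw [if_neg, mul_zero]
      exact fun h => hj (Fin.ext h.symm)
    · simp
  · rw [dif_neg h, Finset.sum_eq_zero]
    · split_ifs <;> simp
    · intro j _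
      rw [if_neg (by omega), mul_zero]

theorem coeff_coeffDer_monicOf_eq_zero (D : Derivation ℤ A A) {k : ℕ} (c : Fin k → A) {i : ℕ}
    (hi : k ≤ i) : (coeffDer D (monicOf c)).coeff i = 0 := by
  rw [coeff_coeffDer, coeff_monicOf, dif_neg (by omega)]
  split_ifs <;> simp

/-- The set of coefficients of the first `s` digits of `F`. -/
def digitSet (G F : A[X]) (s : ℕ) : Set A := {φ | ∃ t < s, ∃ i, φ = (digit G F t).coeff i}

/-- The ideal spanned by the first `m` coefficients of `F * G` and the coefficients of the first
`s` digits of `F`. -/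
def chain (m : ℕ) (G F : A[X]) (s : ℕ) : Ideal A :=
  Ideal.span (Set.range (fun j : Fin m => (F * G).coeff j) ∪ digitSet G F s)

theorem coeff_mem_chain {m : ℕ} (G F : A[X]) (s : ℕ) {j : ℕ} (hj : j < m) :
    (F * G).coeff j ∈ chain m G F s :=
  Ideal.subset_span (Or.inl ⟨⟨j, hj⟩, rfl⟩)

theorem digit_mem_chain (m : ℕ) (G F : A[X]) {s t : ℕ} (ht : t < s) :
    digit G F t ∈ (chain m G F s).map C :=
  Ideal.mem_map_C_iff.2 fun i => Ideal.subset_span (Or.inr ⟨t, ht, i, rfl⟩)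

theorem chain_mono (m : ℕ) (G F : A[X]) : Monotone (chain m G F) := by
  intro s t h
  refine Ideal.span_mono (Set.union_subset_union_right _ ?_)
  rintro _ ⟨u, hu, i, rfl⟩
  exact ⟨u, hu.trans_le h, i, rfl⟩

theorem chain_le_iff {m : ℕ} {G F : A[X]} {s : ℕ} {K : Ideal A} :
    chain m G F s ≤ K ↔
      (∀ j : Fin m, (F * G).coeff j ∈ K) ∧ ∀ t < s, digit G F t ∈ K.map C := by
  rw [chain, Ideal.span_le, Set.union_subset_iff, Set.range_subset_iff]
  refine and_congr Iff.rfl ⟨fun h t ht => Ideal.mem_map_C_iff.2 fun i => h ⟨t, ht, i, rfl⟩, ?_⟩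
  rintro h _ ⟨t, ht, i, rfl⟩
  exact Ideal.mem_map_C_iff.1 (h t ht) i

/-! ### Jacobian extensions of the digit ideals for generic f and g -/

variable {n r : ℕ} (x : Fin n ⊕ Fin r → A) (D : Fin n ⊕ Fin r → Derivation ℤ A A)

theorem coeff_digit_monicOf [Nontrivial A] {i t : ℕ} (hi : r ≤ i) {F : A[X]} (c : Fin r → A) :
    (digit (monicOf c) F t).coeff i = 0 := by
  refine coeff_eq_zero_of_degree_lt ((degree_digit_lt (monic_monicOf c) F t).trans_le ?_)
  rw [degree_eq_natDegree (monic_monicOf c).ne_zero, natDegree_monicOf]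
  exact_mod_cast hi

theorem natDegree_quo_one [Nontrivial A] (a : Fin n → A) (b : Fin r → A) :
    (quo (monicOf b) (monicOf a) 1).natDegree = n - r := by
  rw [quo, quo, natDegree_divByMonic _ (monic_monicOf b), natDegree_monicOf, natDegree_monicOf]

/-- The Jacobian extension of each ideal of the chain is contained in the next one. -/
theorem jacExt_chain_le [Nontrivial A] (hrn : r ≤ n) (s : ℕ) :
    jacExt D (n + 1) (chain (n + r) (monicOf (x ∘ Sum.inr)) (monicOf (x ∘ Sum.inl)) s) ≤
      chain (n + r) (monicOf (x ∘ Sum.inr)) (monicOf (x ∘ Sum.inl)) (s + 1) := by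
  set F := monicOf (x ∘ Sum.inl) with hF
  set G := monicOf (x ∘ Sum.inr) with hG
  have hGm : G.Monic := monic_monicOf _
  set K := chain (n + r) G F (s + 1) with hK
  let e : Fin n → Fin n ⊕ Fin r → A := fun k v => (derQuo (D v) G F 0).coeff k
  -- Gradients that are combinations of the n vectors `e k` up to entries in `K`.
  let Λ : Submodule A (Fin n ⊕ Fin r → A) :=
    Submodule.span A (Set.range e) ⊔ Submodule.pi Set.univ fun _ => K
  have hΛK : ∀ w : Fin n ⊕ Fin r → A, (∀ v, w v ∈ K) → w ∈ Λ := fun w hw =>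
    Submodule.mem_sup_right (by simpa [Submodule.mem_pi] using hw)
  have hΛ : ∀ w ∈ Λ, ∃ α : Fin n → A, ∀ v, w v - ∑ k, α k * e k v ∈ K := by
    intro w hw
    obtain ⟨y, hy, z, hz, rfl⟩ := Submodule.mem_sup.1 hw
    obtain ⟨α, rfl⟩ := (Submodule.mem_span_range_iff_exists_fun A).1 hy
    refine ⟨α, fun v => ?_⟩
    simpa using hz v (Set.mem_univ v)
  have h0 : ∀ i, (fun v => (derQuo (D v) G F 0).coeff i) ∈ Λ := by
    intro i
    by_cases hi : i < n
    · exact Submodule.mem_sup_left (Submodule.subset_span ⟨⟨i, hi⟩, rfl⟩)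
    · convert Λ.zero_mem using 1
      funext v
      rw [derQuo_zero, coeff_add, coeff_coeffDer_monicOf_eq_zero _ _ (by omega), zero_add]
      -- For r > 0 the product q_1 δg has degree at most (n - r) + (r - 1) < n. For r = 0 the
      -- truncated `r - 1` would spoil this count.
      by_cases hr : r = 0
      · have : coeffDer (D v) G = 0 := by
          ext j
          exact coeff_coeffDer_monicOf_eq_zero _ _ (by omega)
        simp [this]
      · refine coeff_eq_zero_of_natDegree_lt (natDegree_mul_le.trans_lt ?_)
        have : (coeffDer (D v) G).natDegree < r := by
          have := natDegree_le_iff_coeff_eq_zero.2 fun i (hi : r - 1 < i) =>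
            coeff_coeffDer_monicOf_eq_zero (D v) (x ∘ Sum.inr) (i := i) (by omega)
          rw [← hG] at this
          omega
        rw [natDegree_quo_one]
        omega
  have hdig : ∀ t ≤ s, digit G F t ∈ K.map C := fun t ht => digit_mem_chain _ _ _ (by omega)
  refine jacExt_le_of_combination D e (chain_mono _ _ _ (Nat.le_succ s)) ?_
  rintro _ (⟨j, rfl⟩ | ⟨t, ht, i, rfl⟩)
  · refine hΛ _ ?_
    have e1 : (fun v => D v ((F * G).coeff j)) =
        (fun v => (G * derQuo (D v) G F 0).coeff j) +
          fun v => (digit G F 0 * coeffDer (D v) G).coeff j := by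
      funext v
      rw [← coeff_coeffDer, coeffDer_mul_eq, coeff_add, Pi.add_apply]
    rw [e1]
    refine Λ.add_mem ?_ (hΛK _ fun v => ?_)
    · exact functional_family_mem (lcoeff A j ∘ₗ LinearMap.mulLeft A G) h0
    · exact Ideal.mem_map_C_iff.1 (Ideal.mul_mem_right _ _ (hdig 0 (by omega))) j
  · exact hΛ _ ((coeff_derQuo_family_mem hGm hΛK h0 hdig t ht).2 i)

theorem coeffDer_inl_monicOf_inl
    (hD : ∀ v w, D v (x w) = if v = w then 1 else 0) (l : Fin n) :
    coeffDer (D (Sum.inl l)) (monicOf (x ∘ Sum.inl)) = X ^ (l : ℕ) := by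
  rw [coeffDer_monicOf, Finset.sum_eq_single l] <;> simp +contextual [hD, eq_comm]

theorem coeffDer_inl_monicOf_inr
    (hD : ∀ v w, D v (x w) = if v = w then 1 else 0) (l : Fin n) :
    coeffDer (D (Sum.inl l)) (monicOf (x ∘ Sum.inr)) = 0 := by
  rw [coeffDer_monicOf, Finset.sum_eq_zero]
  simp [hD]

theorem coeffDer_inr_monicOf_inl
    (hD : ∀ v w, D v (x w) = if v = w then 1 else 0) (l : Fin r) :
    coeffDer (D (Sum.inr l)) (monicOf (x ∘ Sum.inl)) = 0 := by
  rw [coeffDer_monicOf, Finset.sum_eq_zero]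
  simp [hD]

theorem coeffDer_inr_monicOf_inr
    (hD : ∀ v w, D v (x w) = if v = w then 1 else 0) (l : Fin r) :
    coeffDer (D (Sum.inr l)) (monicOf (x ∘ Sum.inr)) = X ^ (l : ℕ) := by
  rw [coeffDer_monicOf, Finset.sum_eq_single l] <;> simp +contextual [hD, eq_comm]

/-- The top `n` nonleading coefficients of `F * G` have a unitriangular Jacobian matrix with respect
to the coefficients of `F`. -/
theorem det_coeffDer_mul_eq_one (hD : ∀ v w, D v (x w) = if v = w then 1 else 0) :
    (Matrix.of fun k l : Fin n => D (Sum.inl l)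
      ((monicOf (x ∘ Sum.inl) * monicOf (x ∘ Sum.inr)).coeff (r + k))).det = 1 := by
  have h : ∀ k l : Fin n, D (Sum.inl l)
      ((monicOf (x ∘ Sum.inl) * monicOf (x ∘ Sum.inr)).coeff (r + k)) =
      if (l : ℕ) ≤ r + k then (monicOf (x ∘ Sum.inr)).coeff (r + k - l) else 0 := by
    intro k l
    rw [← coeff_coeffDer, Derivation.leibniz, coeffDer_inl_monicOf_inl x D hD,
      coeffDer_inl_monicOf_inr x D hD, smul_zero, zero_add, smul_eq_mul, coeff_mul_X_pow']
  rw [Matrix.det_of_isUpperTriangular]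
  · refine Finset.prod_eq_one fun k _ => ?_
    rw [Matrix.of_apply, h, if_pos (by omega), Nat.add_sub_cancel, coeff_monicOf_self]
  · intro k l hkl
    rw [Matrix.of_apply, h, if_pos (by have : (l : ℕ) < k := hkl; omega)]
    have : (l : ℕ) < k := hkl
    rw [coeff_monicOf, dif_neg (by omega), if_neg (by omega)]

theorem jacExt_chain_eq_top (hD : ∀ v w, D v (x w) = if v = w then 1 else 0) (s : ℕ) :
    jacExt D n (chain (n + r) (monicOf (x ∘ Sum.inr)) (monicOf (x ∘ Sum.inl)) s) = ⊤ := by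
  rw [Ideal.eq_top_iff_one, ← det_coeffDer_mul_eq_one x D hD]
  exact det_mem_jacExt D (fun k : Fin n => coeff_mem_chain _ _ s (by omega)) _

/-- Each ideal of the chain is contained in the Jacobian extension of the previous one. -/
theorem chain_le_jacExt [Nontrivial A]
    (hD : ∀ v w, D v (x w) = if v = w then 1 else 0)
    (hr : 1 ≤ r) (hrn : r ≤ n) (hunit : ∀ k : ℕ, IsUnit ((k + 1 : ℕ) : A))
    (s : ℕ) :
    chain (n + r) (monicOf (x ∘ Sum.inr)) (monicOf (x ∘ Sum.inl)) (s + 1) ≤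
      jacExt D (n + 1) (chain (n + r) (monicOf (x ∘ Sum.inr)) (monicOf (x ∘ Sum.inl)) s) := by
  have hdet := det_coeffDer_mul_eq_one x D hD
  set F := monicOf (x ∘ Sum.inl) with hF
  set G := monicOf (x ∘ Sum.inr) with hG
  have hGm : G.Monic := monic_monicOf _
  set J := chain (n + r) G F s with hJ
  let w : Fin n ⊕ Fin r := Sum.inr ⟨0, hr⟩
  let q : Fin n → A := fun l => (quo G F 1).coeff l
  -- The coefficients of q_1 are the weights that make Y(f) = -q_1 and hence Y(fg) = f - g q_1 =
  -- ρ_0. Only n weights are needed, since deg q_1 = n - r < n.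
  let Y : Derivation ℤ A A := D w - ∑ l, q l • D (Sum.inl l)
  have hY : ∀ f, Y f = D w f - ∑ l, q l * D (Sum.inl l) f := by
    intro f
    have h : (∑ l, q l • D (Sum.inl l)) f = ∑ l, (q l • D (Sum.inl l)) f := by
      rw [← Derivation.coeFnAddMonoidHom_apply, map_sum, Finset.sum_apply]
      rfl
    rw [Derivation.sub_apply, h]
    rfl
  have hYp : ∀ p : A[X], coeffDer Y p = coeffDer (D w) p - ∑ l, C (q l) * coeffDer (D (Sum.inl l)) p := by
    intro p
    ext i
    simp [coeff_coeffDer, hY, finsetSum_coeff]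
  have hYG : coeffDer Y G = 1 := by
    rw [hYp, coeffDer_inr_monicOf_inr x D hD]
    simp [hG, coeffDer_inl_monicOf_inr x D hD]
  have hYF : coeffDer Y F = - quo G F 1 := by
    rw [hYp, coeffDer_inr_monicOf_inl x D hD, zero_sub, neg_inj]
    conv_rhs => rw [(quo G F 1).as_sum_range' n (by rw [natDegree_quo_one]; omega),
      Finset.sum_range]
    refine Finset.sum_congr rfl fun l _ => ?_
    rw [coeffDer_inl_monicOf_inl x D hD, C_mul_X_pow_eq_monomial]
  have hYc : ∀ j, Y ((F * G).coeff j) = (digit G F 0).coeff j := by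
    intro j
    rw [← coeff_coeffDer, coeffDer_mul_eq, derQuo_zero, hYG, hYF]
    simp
  have key : ∀ f ∈ J, Y f ∈ jacExt D (n + 1) J := fun f hf =>
    derivative_mem_jacExt D (h := fun k : Fin n => (F * G).coeff (r + k))
      (fun k => coeff_mem_chain _ _ s (by omega)) Sum.inl hdet w q hY
      (fun k => by
        rw [hYc, coeff_digit_monicOf (by omega)]
        exact J.zero_mem) hf
  rw [chain_le_iff]
  refine ⟨fun j => le_jacExt _ _ _ (coeff_mem_chain _ _ s j.2), fun t ht => ?_⟩
  rw [Ideal.mem_map_C_iff]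
  intro i
  rcases (Nat.lt_succ_iff_lt_or_eq.1 ht) with ht | rfl
  · exact le_jacExt _ _ _ (Ideal.mem_map_C_iff.1 (digit_mem_chain _ _ _ ht) i)
  -- The digit ρ_0 comes from applying `Y` to the c_j; a later digit comes from applying `Y` to the
  -- digit before it.
  rcases t with _ | t
  · by_cases hi : i < n + r
    · rw [← hYc]
      exact key _ (coeff_mem_chain _ _ _ hi)
    · rw [coeff_digit_monicOf (by omega)]
      exact Ideal.zero_mem _
  · have h1 := Ideal.mem_map_C_iff.1 (coeffDer_digit_add_mem Y hGm hYG hYF (K := J) (s := t)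
      fun u hu => digit_mem_chain _ _ _ (by omega)) i
    rw [coeff_add, coeff_coeffDer, coeff_C_mul] at h1
    have h2 := key _ (Ideal.mem_map_C_iff.1 (digit_mem_chain (n + r) G F t.lt_succ_self) i)
    have h3 := Ideal.sub_mem _ (le_jacExt D (n + 1) J h1) h2
    rw [add_sub_cancel_left] at h3
    -- The factor to cancel is t + 2; characteristic zero enters here.
    have h4 := hunit (t + 1)
    rw [← Ideal.unit_mul_mem_iff_mem _ h4]
    convert h3 using 2
    push_cast
    ring

theorem jacExt_chain [Nontrivial A]
    (hD : ∀ v w, D v (x w) = if v = w then 1 else 0)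
    (hr : 1 ≤ r) (hrn : r ≤ n) (hunit : ∀ k : ℕ, IsUnit ((k + 1 : ℕ) : A))
    (s : ℕ) :
    jacExt D (n + 1) (chain (n + r) (monicOf (x ∘ Sum.inr)) (monicOf (x ∘ Sum.inl)) s) =
      chain (n + r) (monicOf (x ∘ Sum.inr)) (monicOf (x ∘ Sum.inl)) (s + 1) :=
  le_antisymm (jacExt_chain_le x D hrn s) (chain_le_jacExt x D hD hr hrn hunit s)

/-- The ideals of the chain are proper as long as there are enough digits. -/
theorem chain_ne_top {B : Type*} [CommRing B] [Nontrivial B] (ε : A →+* B) (hε : ∀ v, ε (x v) = 0)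
    {s : ℕ} (hs : s * r ≤ n) :
    chain (n + r) (monicOf (x ∘ Sum.inr)) (monicOf (x ∘ Sum.inl)) s ≠ ⊤ := by
  have hz : ∀ k, monicOf (fun _ : Fin k => (0 : B)) = X ^ k := fun k => by simp [monicOf]
  have hF : (monicOf (x ∘ Sum.inl)).map ε = X ^ n := by
    rw [map_monicOf, ← hz]
    congr 1
    funext i
    exact hε _
  have hG : (monicOf (x ∘ Sum.inr)).map ε = X ^ r := by
    rw [map_monicOf, ← hz]
    congr 1
    funext i
    exact hε _
  refine ne_top_of_le_ne_top (RingHom.ker_ne_top ε) (chain_le_iff.2 ⟨fun j => ?_, fun t ht => ?_⟩)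
  · rw [RingHom.mem_ker, ← coeff_map, Polynomial.map_mul, hF, hG, ← pow_add, coeff_X_pow,
      if_neg (by omega)]
  · rw [Ideal.mem_map_C_iff]
    intro i
    rw [RingHom.mem_ker, ← coeff_map, map_digit ε (monic_monicOf _), hF, hG,
      digit_X_pow ((Nat.mul_le_mul_right r ht).trans hs), coeff_zero]

end Chain

/-! ### Residues at infinity of `p / G ^ s` -/

section Residues

variable {A : Type*} [CommRing A]

/-- The coefficient of `x⁻¹` in the expansion of `p / G ^ s` at infinity, for a monic polynomial
`G` of positive degree and `s ≥ 1`. -/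
noncomputable def res (G : A[X]) (s : ℕ) : A[X] →ₗ[A] A :=
  lcoeff A (s * G.natDegree - 1) ∘ₗ modByMonicHom (G ^ s)

theorem natDegree_lt_of_degree_lt_of_pos {p : A[X]} {k : ℕ} (hk : 0 < k) (h : p.degree < k) :
    p.natDegree < k := by
  by_cases hp : p = 0
  · simpa [hp] using hk
  · exact (natDegree_lt_iff_degree_lt hp).2 h

theorem degree_pow_of_monic [Nontrivial A] {G : A[X]} (hG : G.Monic) (s : ℕ) :
    (G ^ s).degree = (s * G.natDegree : ℕ) := by
  rw [degree_eq_natDegree (hG.pow s).ne_zero, hG.natDegree_pow]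

theorem res_mul_add [Nontrivial A] {G : A[X]} (hG : G.Monic) (s : ℕ) (p : A[X]) {q : A[X]}
    (hq : q.degree < (s * G.natDegree : ℕ)) :
    res G s (G ^ s * p + q) = q.coeff (s * G.natDegree - 1) := by
  rw [← degree_pow_of_monic hG] at hq
  change ((G ^ s * p + q) %ₘ G ^ s).coeff _ = _
  rw [(divByMonic_modByMonic_of_degree_lt (hG.pow s) hq).2]

theorem res_of_degree_lt [Nontrivial A] {G : A[X]} (hG : G.Monic) (s : ℕ) {q : A[X]}
    (hq : q.degree < (s * G.natDegree : ℕ)) : res G s q = q.coeff (s * G.natDegree - 1) := by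
  simpa using res_mul_add hG s 0 hq

theorem res_succ_pow_mul [Nontrivial A] {G : A[X]} (hG : G.Monic) (hG0 : 1 ≤ G.natDegree) (s : ℕ)
    (p : A[X]) : res G (s + 1) (G ^ s * p) = res G 1 p := by
  have hv : (p %ₘ G).degree < G.degree := degree_modByMonic_lt _ hG
  have hv' : (p %ₘ G).natDegree < G.natDegree := natDegree_modByMonic_lt _ hG (by
    rintro rfl
    simp at hG0)
  have e : G ^ s * p = G ^ (s + 1) * (p /ₘ G) + G ^ s * (p %ₘ G) := by
    conv_lhs => rw [← modByMonic_add_div p G]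
    ring
  have e1 : p = G ^ 1 * (p /ₘ G) + p %ₘ G := by
    conv_lhs => rw [← modByMonic_add_div p G]
    ring
  conv_rhs => rw [e1, res_mul_add hG 1 _ (by
    rwa [one_mul, ← degree_eq_natDegree hG.ne_zero])]
  rw [e, res_mul_add hG]
  · have h : (s + 1) * G.natDegree - 1 = s * G.natDegree + (G.natDegree - 1) := by
      rw [add_mul]
      omega
    have h1 : (G ^ s).coeff (s * G.natDegree) = 1 := by
      rw [← hG.natDegree_pow, (hG.pow s).coeff_natDegree]
    rw [h, coeff_mul_add_eq_of_natDegree_le (hG.natDegree_pow s).le (by omega), h1, one_mul,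
      one_mul]
  · refine (degree_mul_le _ _).trans_lt ?_
    rw [degree_pow_of_monic hG, add_mul, one_mul, Nat.cast_add, ← degree_eq_natDegree hG.ne_zero]
    exact WithBot.add_lt_add_left (WithBot.coe_ne_bot) hv

/-- This is D(p / G^{s+1}) = Dp / G^{s+1} - (s+1) p DG / G^{s+2}, read off at x⁻¹. -/
theorem der_res [Nontrivial A] (D : Derivation ℤ A A) {G : A[X]} (hG : G.Monic)
    (hG0 : 1 ≤ G.natDegree) (s : ℕ) (p : A[X]) :
    D (res G (s + 1) p) = res G (s + 1) (coeffDer D p) -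
      ((s + 1 : ℕ) : A) * res G (s + 2) (p * coeffDer D G) := by
  set Q := p /ₘ G ^ (s + 1)
  set R := p %ₘ G ^ (s + 1) with hR
  have hRd : R.degree < ((s + 1) * G.natDegree : ℕ) := by
    rw [← degree_pow_of_monic hG]
    exact degree_modByMonic_lt _ (hG.pow _)
  have hp : p = G ^ (s + 1) * Q + R := by
    rw [add_comm]
    exact (modByMonic_add_div _ _).symm
  have h1 : coeffDer D p = G ^ (s + 1) * coeffDer D Q +
      (((s + 1 : ℕ) : A) • (G ^ s * (Q * coeffDer D G)) + coeffDer D R) := by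
    conv_lhs => rw [hp]
    rw [map_add, Derivation.leibniz, Derivation.leibniz_pow, smul_eq_C_mul]
    simp only [smul_eq_mul, nsmul_eq_mul, map_natCast, Nat.add_sub_cancel]
    ring
  have h2 : D (res G (s + 1) p) = res G (s + 1) (coeffDer D R) := by
    rw [res_of_degree_lt hG _ ((degree_coeffDer_le _ _).trans_lt hRd), coeff_coeffDer]
    rfl
  have h3 : res G (s + 1) (G ^ (s + 1) * coeffDer D Q) = 0 := by
    simpa using res_mul_add hG (s + 1) (coeffDer D Q) (q := 0) (by
        rw [degree_zero]
        exact WithBot.bot_lt_coe _)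
  have hs : G.natDegree ≤ (s + 1) * G.natDegree := Nat.le_mul_of_pos_left _ (Nat.succ_pos s)
  -- The degree is at most (s+2) deg G - 2, one less than what the residue detects.
  have h4 : res G (s + 2) (R * coeffDer D G) = 0 := by
    have hRn : R.natDegree ≤ (s + 1) * G.natDegree - 1 := by
      have := natDegree_lt_of_degree_lt_of_pos (by omega) hRd
      omega
    have hGn : (coeffDer D G).natDegree ≤ G.natDegree - 1 := by
      have h := degree_coeffDer_lt D hG
      rw [degree_eq_natDegree hG.ne_zero] at h
      have := natDegree_lt_of_degree_lt_of_pos (by omega) h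
      omega
    have hn : (R * coeffDer D G).natDegree < (s + 2) * G.natDegree - 1 := by
      refine natDegree_mul_le.trans_lt ?_
      have : (s + 2) * G.natDegree = (s + 1) * G.natDegree + G.natDegree := by ring
      omega
    rw [res_of_degree_lt hG, coeff_eq_zero_of_natDegree_lt hn]
    exact degree_le_natDegree.trans_lt (by exact_mod_cast hn.trans_le (Nat.sub_le _ _))
  have h5 : res G (s + 2) (p * coeffDer D G) = res G 1 (Q * coeffDer D G) := by
    have : p * coeffDer D G = G ^ (s + 1) * (Q * coeffDer D G) + R * coeffDer D G := by
      conv_lhs => rw [hp]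
      ring
    rw [this, map_add, h4, add_zero, res_succ_pow_mul hG hG0]
  rw [h2, h5, h1, map_add, map_add, h3, map_smul, res_succ_pow_mul hG hG0, smul_eq_mul]
  ring

/-- Coefficients of polynomial quotients are residues. -/
theorem coeff_X_pow_mul_divByMonic [Nontrivial A] {G : A[X]} (hG : G.Monic)
    (hG0 : 1 ≤ G.natDegree) (i : ℕ) (p : A[X]) :
    ((X ^ (i + 1) * p) /ₘ G).coeff i = res G 1 p := by
  have hG1 : G ≠ 1 := by
    rintro rfl
    simp at hG0
  set u := p /ₘ G
  set v := p %ₘ G with hv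
  have hvn : v.natDegree < G.natDegree := natDegree_modByMonic_lt _ hG hG1
  have hp : p = G * u + v := by
    rw [add_comm]
    exact (modByMonic_add_div _ _).symm
  have h1 : X ^ (i + 1) * p = X ^ (i + 1) * v + G * (X ^ (i + 1) * u) := by
    rw [hp]
    ring
  set w := X ^ (i + 1) * v with hw
  have hwn : w.natDegree ≤ i + G.natDegree := by
    refine natDegree_mul_le.trans ?_
    rw [natDegree_X_pow]
    omega
  have hzn : (w /ₘ G).natDegree ≤ i := by
    rw [natDegree_divByMonic _ hG]
    omega
  have h2 : res G 1 p = w.coeff (G.natDegree + i) := by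
    change (p %ₘ G ^ 1).coeff (1 * G.natDegree - 1) = _
    rw [pow_one, one_mul, ← hv, hw, show G.natDegree + i = (G.natDegree - 1) + (i + 1) by omega,
      mul_comm, coeff_mul_X_pow]
  have h3 : w.coeff (G.natDegree + i) = (w /ₘ G).coeff i := by
    conv_lhs => rw [← modByMonic_add_div w G]
    rw [coeff_add, coeff_mul_add_eq_of_natDegree_le le_rfl hzn, hG.coeff_natDegree, one_mul,
      coeff_eq_zero_of_natDegree_lt (lt_of_lt_of_le (natDegree_modByMonic_lt w hG hG1)
        (Nat.le_add_right _ _)), zero_add]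
  rw [h1, add_divByMonic hG, mul_divByMonic_cancel_left _ hG, coeff_add, h2, h3, mul_comm _ u,
    coeff_mul_X_pow', if_neg (by omega), add_zero]

/-- A polynomial of degree less than that of `G` is zero modulo `K` as soon as all its moments
are. -/
theorem mem_of_res_mem [Nontrivial A] {G : A[X]} (hG : G.Monic) (hG0 : 1 ≤ G.natDegree)
    {K : Ideal A} {v : A[X]} (hv : v.natDegree < G.natDegree)
    (h : ∀ i < G.natDegree, res G 1 (v * X ^ i) ∈ K) : v ∈ K.map C := by
  -- The i-th moment involves only the top i + 1 coefficients of `v`, the lowest of them with factor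
  -- one; so the coefficients are recovered from the top down.
  have key : ∀ i < G.natDegree, v.coeff (G.natDegree - 1 - i) ∈ K := by
    intro i
    induction i using Nat.strong_induction_on with
    | _ i ih =>
    intro hi
    let lo : A[X] := ∑ j ∈ Finset.range (G.natDegree - i), monomial j (v.coeff j)
    have hhi : v - lo ∈ K.map C := by
      rw [Ideal.mem_map_C_iff]
      intro j
      have hlo : lo.coeff j = if j < G.natDegree - i then v.coeff j else 0 := by
        simp [lo, finsetSum_coeff, coeff_monomial]
      rw [coeff_sub, hlo]
      split_ifs with hj
      · rw [sub_self]
        exact K.zero_mem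
      · rw [sub_zero]
        by_cases hj' : j < G.natDegree
        · have := ih (G.natDegree - 1 - j) (by omega) (by omega)
          rwa [show G.natDegree - 1 - (G.natDegree - 1 - j) = j by omega] at this
        · rw [coeff_eq_zero_of_natDegree_lt (by omega)]
          exact K.zero_mem
    have hlon : lo.natDegree ≤ G.natDegree - 1 - i := by
      refine natDegree_sum_le_of_forall_le _ _ fun j hj => (natDegree_monomial_le _).trans ?_
      have := Finset.mem_range.1 hj
      omega
    have h1 : res G 1 (lo * X ^ i) = v.coeff (G.natDegree - 1 - i) := by
      rw [res_of_degree_lt hG, one_mul, show G.natDegree - 1 = (G.natDegree - 1 - i) + i by omega,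
        coeff_mul_X_pow]
      · simp only [lo, finsetSum_coeff, coeff_monomial, Nat.add_sub_cancel]
        rw [Finset.sum_ite_eq', if_pos (Finset.mem_range.2 (by omega))]
      · refine degree_le_natDegree.trans_lt ?_
        have : (lo * X ^ i).natDegree < 1 * G.natDegree := by
          refine natDegree_mul_le.trans_lt ?_
          rw [natDegree_X_pow]
          omega
        exact_mod_cast this
    have h2 := functional_mem (res G 1) (Ideal.mul_mem_right (X ^ i) _ hhi)
    rw [sub_mul, map_sub, h1] at h2
    have h3 := K.sub_mem (h i hi) h2
    rwa [sub_sub_cancel] at h3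
  rw [Ideal.mem_map_C_iff]
  intro j
  by_cases hj : j < G.natDegree
  · have := key (G.natDegree - 1 - j) (by omega)
    rwa [show G.natDegree - 1 - (G.natDegree - 1 - j) = j by omega] at this
  · rw [coeff_eq_zero_of_natDegree_lt (by omega)]
    exact K.zero_mem

theorem sub_pow_mul_quo_mem {G F : A[X]} {K : Ideal A} {t : ℕ}
    (hK : ∀ u < t, digit G F u ∈ K.map C) : F - G ^ t * quo G F t ∈ K.map C := by
  induction t with
  | zero => simp [quo]
  | succ t ih =>
    have e : F - G ^ (t + 1) * quo G F (t + 1) =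
        F - G ^ t * quo G F t + G ^ t * digit G F t := by
      rw [quo_eq G F t]
      ring
    rw [e]
    exact Ideal.add_mem _ (ih fun u hu => hK u (by omega))
      (Ideal.mul_mem_left _ _ (hK t (by omega)))

/-- Modulo the previous digits, a digit vanishes if and only if the corresponding residues do. -/
theorem digit_mem_iff [Nontrivial A] {G F : A[X]} (hG : G.Monic) (hG0 : 1 ≤ G.natDegree)
    {K : Ideal A} {t : ℕ} (hK : ∀ u < t, digit G F u ∈ K.map C) :
    digit G F t ∈ K.map C ↔ ∀ i < G.natDegree, res G (t + 1) (F * X ^ i) ∈ K := by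
  have hd : ∀ i, res G (t + 1) (F * X ^ i) - res G 1 (digit G F t * X ^ i) ∈ K := by
    intro i
    -- Polynomial multiples of `G` have no residue over `G`, so q_t may be replaced by its remainder
    -- ρ_t.
    have h1 : res G 1 (quo G F t * X ^ i) = res G 1 (digit G F t * X ^ i) := by
      have e : quo G F t * X ^ i = G ^ 1 * (quo G F (t + 1) * X ^ i) + digit G F t * X ^ i := by
        conv_lhs => rw [quo_eq]
        ring
      have h := res_mul_add hG 1 (quo G F (t + 1) * X ^ i) (q := 0) (by
        rw [degree_zero]
        exact WithBot.bot_lt_coe _)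
      rw [add_zero, coeff_zero] at h
      rw [e, map_add, h, zero_add]
    rw [← h1, ← res_succ_pow_mul hG hG0 t, ← map_sub, ← mul_assoc, ← sub_mul]
    exact functional_mem _ (Ideal.mul_mem_right _ _ (sub_pow_mul_quo_mem hK))
  constructor
  · intro h i _
    rw [← sub_add_cancel (res G (t + 1) (F * X ^ i)) (res G 1 (digit G F t * X ^ i))]
    exact K.add_mem (hd i) (functional_mem _ (Ideal.mul_mem_right _ _ h))
  · intro h
    refine mem_of_res_mem hG hG0 (natDegree_modByMonic_lt _ hG ?_) fun i hi => ?_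
    · rintro rfl
      simp at hG0
    · rw [← Ideal.neg_mem_iff]
      have := K.sub_mem (hd i) (h i hi)
      rwa [sub_sub_cancel_left] at this

theorem digits_mem_iff [Nontrivial A] {G F : A[X]} (hG : G.Monic) (hG0 : 1 ≤ G.natDegree)
    {K : Ideal A} (s : ℕ) :
    (∀ t < s, digit G F t ∈ K.map C) ↔
      ∀ t < s, ∀ i < G.natDegree, res G (t + 1) (F * X ^ i) ∈ K := by
  induction s with
  | zero => simp
  | succ s ih =>
    simp only [Nat.lt_succ_iff_lt_or_eq, or_imp, forall_and, forall_eq]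
    constructor
    · rintro ⟨h1, h2⟩
      exact ⟨ih.1 h1, (digit_mem_iff hG hG0 h1).1 h2⟩
    · rintro ⟨h1, h2⟩
      exact ⟨ih.2 h1, (digit_mem_iff hG hG0 (ih.2 h1)).2 h2⟩

/-- The recursion for the coefficients of the quotient of `X ^ r * F` by a monic polynomial of
degree `r`. -/
theorem coeff_divByMonic_rec [Nontrivial A] {F G : A[X]} (hG : G.Monic) {n r j : ℕ}
    (hGr : G.natDegree = r) (hFn : F.natDegree = n) (hF : F.Monic) (hj : 1 ≤ j) (hjn : j ≤ n) :
    ((X ^ r * F) /ₘ G).coeff (n - j) = F.coeff (n - j) - (if j ≤ r then G.coeff (r - j) else 0) -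
      ∑ i ∈ Finset.range j, if 1 ≤ i ∧ j - i ≤ r then
        ((X ^ r * F) /ₘ G).coeff (n - i) * G.coeff (r - (j - i)) else 0 := by
  set Q := (X ^ r * F) /ₘ G with hQ
  have hdeg : (X ^ r * F).natDegree = n + r := by
    rw [(monic_X_pow r).natDegree_mul hF, natDegree_X_pow, hFn, add_comm]
  have hQn : Q.natDegree = n := by
    rw [hQ, natDegree_divByMonic _ hG, hdeg, hGr, Nat.add_sub_cancel]
  have hQ1 : Q.coeff n = 1 := by
    have h := leadingCoeff_divByMonic_of_monic (p := X ^ r * F) hG (by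
      rw [degree_eq_natDegree hG.ne_zero, degree_eq_natDegree ((monic_X_pow r).mul hF).ne_zero, hdeg, hGr]
      exact_mod_cast Nat.le_add_left r n)
    rw [leadingCoeff, ← hQ, hQn] at h
    rw [h]
    exact (monic_X_pow r).mul hF
  have hmod : ((X ^ r * F) %ₘ G).coeff (n + r - j) = 0 := by
    refine coeff_eq_zero_of_degree_lt ((degree_modByMonic_lt _ hG).trans_le ?_)
    rw [degree_eq_natDegree hG.ne_zero, hGr]
    exact_mod_cast (by omega : r ≤ n + r - j)
  have h1 : F.coeff (n - j) = (Q * G).coeff (n + r - j) := by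
    have := congrArg (fun p => p.coeff (n + r - j)) (modByMonic_add_div (X ^ r * F) G)
    simp only [coeff_add, hmod, zero_add] at this
    rw [mul_comm Q, this, coeff_X_pow_mul', if_pos (by omega)]
    congr 1
    omega
  have h2 : (Q * G).coeff (n + r - j) = ∑ i ∈ Finset.range (j + 1),
      if j - i ≤ r then Q.coeff (n - i) * G.coeff (r - (j - i)) else 0 := by
    rw [coeff_mul, Finset.Nat.sum_antidiagonal_eq_sum_range_succ
      (fun k l => Q.coeff k * G.coeff l), ← Finset.sum_filter]
    symm
    refine Finset.sum_of_injOn (fun i => n - i) ?_ ?_ ?_ ?_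
    · intro a ha b hb hab
      simp only [Finset.coe_filter, Finset.mem_range, Set.mem_ofPred_eq] at ha hb hab
      omega
    · intro a ha
      simp only [Finset.coe_filter, Finset.mem_range, Set.mem_ofPred_eq, Finset.coe_range,
        Set.mem_Iio] at ha ⊢
      omega
    · intro k hk hk'
      rw [Finset.mem_range] at hk
      by_cases hkn : n < k
      · rw [coeff_eq_zero_of_natDegree_lt (by omega), zero_mul]
      · rw [coeff_eq_zero_of_natDegree_lt (p := G), mul_zero]
        by_contra hcon
        refine hk' ⟨n - k, ?_, by simp only; omega⟩
        simp only [Finset.coe_filter, Finset.mem_range, Set.mem_ofPred_eq]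
        omega
    · intro i hi
      simp only [Finset.mem_filter, Finset.mem_range] at hi
      congr 2
      omega
  -- The quotient is monic of degree n, so the i = 0 term is the bare coefficient b_{r-j} of the
  -- recursion.
  have h3 : ∑ i ∈ Finset.range j, (if j - i ≤ r then Q.coeff (n - i) * G.coeff (r - (j - i)) else 0)
      = (if j ≤ r then G.coeff (r - j) else 0) + ∑ i ∈ Finset.range j, if 1 ≤ i ∧ j - i ≤ r then
        Q.coeff (n - i) * G.coeff (r - (j - i)) else 0 := by
    obtain ⟨j, rfl⟩ := Nat.exists_eq_succ_of_ne_zero (by omega : j ≠ 0)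
    rw [Finset.sum_range_succ', Finset.sum_range_succ' (n := j)]
    simp [hQ1, add_comm]
  have hGr' : G.coeff r = 1 := by rw [← hGr, hG.coeff_natDegree]
  rw [h1, h2, Finset.sum_range_succ, h3, Nat.sub_self, if_pos (Nat.zero_le r), Nat.sub_zero, hGr']
  ring

end Residues

/-! ### The ring of germs with its partial derivatives -/

section GermRing

variable {ι : Type*} [Fintype ι]

/-- The value of a germ at the origin. -/
noncomputable def valueHom : germRing ι →+* ℂ := Filter.Germ.valueRingHom.comp (germRing ι).subtype

theorem valueHom_coord (i : ι) : valueHom (coord i) = 0 := rfl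

instance : Nontrivial (germRing ι) := (valueHom (ι := ι)).domain_nontrivial

theorem isUnit_natCast_succ (k : ℕ) : IsUnit ((k + 1 : ℕ) : germRing ι) := by
  refine IsUnit.of_mul_eq_one (germOf (fun _ => ((k + 1 : ℕ) : ℂ)⁻¹) analyticAt_const) ?_
  refine Subtype.ext ?_
  rw [Subring.coe_mul, Subring.coe_natCast, Subring.coe_one]
  refine (congrArg (Filter.Germ.ofFun (l := 𝓝 (0 : ι → ℂ))) ?_ :
    ((((k + 1 : ℕ) : (ι → ℂ) → ℂ) * fun _ => ((k + 1 : ℕ) : ℂ)⁻¹ : (ι → ℂ) → ℂ) :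
      Filter.Germ (𝓝 (0 : ι → ℂ)) ℂ) = ((1 : (ι → ℂ) → ℂ) : Filter.Germ (𝓝 (0 : ι → ℂ)) ℂ))
  funext p
  simp only [Pi.mul_apply, Pi.natCast_apply, Pi.one_apply]
  exact mul_inv_cancel₀ (Nat.cast_ne_zero.2 (Nat.succ_ne_zero k))

theorem exists_germOf (φ : germRing ι) : ∃ f, ∃ hf : AnalyticAt ℂ f 0, germOf f hf = φ := by
  obtain ⟨_, f, hf, rfl⟩ := φ
  exact ⟨f, hf, rfl⟩

theorem germOf_eq {f g : (ι → ℂ) → ℂ} (hf : AnalyticAt ℂ f 0) (hg : AnalyticAt ℂ g 0)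
    (h : f =ᶠ[𝓝 0] g) : germOf f hf = germOf g hg :=
  Subtype.ext (Filter.Germ.coe_eq.2 h)

theorem eventually_differentiableAt {f : (ι → ℂ) → ℂ} (hf : AnalyticAt ℂ f 0) :
    ∀ᶠ x in 𝓝 0, DifferentiableAt ℂ f x :=
  hf.eventually_analyticAt.mono fun _ h => h.differentiableAt

variable [DecidableEq ι]

theorem analyticAt_fderiv_apply {f : (ι → ℂ) → ℂ} (hf : AnalyticAt ℂ f 0) (i : ι) :
    AnalyticAt ℂ (fun x => fderiv ℂ f x (Pi.single i 1)) 0 :=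
  (ContinuousLinearMap.analyticAt (ContinuousLinearMap.apply ℂ ℂ (Pi.single i (1 : ℂ) : ι → ℂ))
    (fderiv ℂ f 0)).comp hf.fderiv

theorem pderiv_add (i : ι) (φ ψ : germRing ι) : pderiv i (φ + ψ) = pderiv i φ + pderiv i ψ := by
  obtain ⟨f, hf, rfl⟩ := exists_germOf φ
  obtain ⟨g, hg, rfl⟩ := exists_germOf ψ
  refine germOf_eq (analyticAt_fderiv_apply (hf.add hg) i)
    ((analyticAt_fderiv_apply hf i).add (analyticAt_fderiv_apply hg i)) ?_
  filter_upwards [eventually_differentiableAt hf, eventually_differentiableAt hg] with x h1 h2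
  rw [fderiv_add h1 h2]
  rfl

theorem pderiv_mul (i : ι) (φ ψ : germRing ι) :
    pderiv i (φ * ψ) = φ * pderiv i ψ + ψ * pderiv i φ := by
  obtain ⟨f, hf, rfl⟩ := exists_germOf φ
  obtain ⟨g, hg, rfl⟩ := exists_germOf ψ
  refine germOf_eq (analyticAt_fderiv_apply (hf.mul hg) i)
    ((hf.mul (analyticAt_fderiv_apply hg i)).add (hg.mul (analyticAt_fderiv_apply hf i))) ?_
  filter_upwards [eventually_differentiableAt hf, eventually_differentiableAt hg] with x h1 h2
  rw [fderiv_mul h1 h2]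
  rfl

theorem pderiv_coord (i j : ι) : pderiv i (coord j) = if i = j then 1 else 0 := by
  have h : ∀ x : ι → ℂ, fderiv ℂ (fun x : ι → ℂ => x j) x (Pi.single i 1) =
      if i = j then 1 else 0 := by
    intro x
    rw [show (fun x : ι → ℂ => x j) =
      ContinuousLinearMap.proj (R := ℂ) (φ := fun _ : ι => ℂ) j from rfl, ContinuousLinearMap.fderiv]
    simp [Pi.single_apply, eq_comm]
  have hj : AnalyticAt ℂ (fun x : ι → ℂ => x j) 0 :=
    (ContinuousLinearMap.proj (R := ℂ) (φ := fun _ : ι => ℂ) j).analyticAt 0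
  split_ifs with hij
  · refine germOf_eq (analyticAt_fderiv_apply hj i) (analyticAt_const (v := (1 : ℂ)))
      (Filter.Eventually.of_forall fun x => ?_)
    simp only [h, if_pos hij]
  · refine germOf_eq (analyticAt_fderiv_apply hj i) (analyticAt_const (v := (0 : ℂ)))
      (Filter.Eventually.of_forall fun x => ?_)
    simp only [h, if_neg hij]

/-- The partial derivative as a derivation of the ring of germs. -/
noncomputable def pder (i : ι) : Derivation ℤ (germRing ι) (germRing ι) :=
  Derivation.mk' (AddMonoidHom.mk' (pderiv i) (pderiv_add i)).toIntLinearMap (pderiv_mul i)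

theorem pder_apply (i : ι) (φ : germRing ι) : pder i φ = pderiv i φ := rfl

theorem jacobianExt_eq (k : ℕ) (J : Ideal (germRing ι)) : jacobianExt k J = jacExt pder k J := rfl

/-- The ideals Δ_k decrease in k, so all orders up to `k` give the unit ideal. -/
theorem criticalOrder_eq {J : Ideal (germRing ι)} {k : ℕ} (h1 : jacobianExt k J = ⊤)
    (h2 : jacobianExt (k + 1) J ≠ ⊤) : criticalOrder J = k + 1 := by
  refine le_antisymm (Nat.sInf_le h2) (le_csInf ⟨_, h2⟩ fun l hl => ?_)
  by_contra hlk
  exact hl (top_le_iff.1 (h1.symm.le.trans (jacExt_antitone pder J (by omega : l ≤ k))))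

end GermRing

/-! ### The multiplication map -/

section Multiplication

variable (n r : ℕ)

/-- The generic polynomial `f` over the ring of germs. -/
noncomputable def fGerm : (germRing (Fin n ⊕ Fin r))[X] := monicOf (coord ∘ Sum.inl)

/-- The generic polynomial `g` over the ring of germs. -/
noncomputable def gGerm : (germRing (Fin n ⊕ Fin r))[X] := monicOf (coord ∘ Sum.inr)

/-- Polynomials over the ring of all functions specialize both to values at points and to germs. -/
theorem germOf_mulMap (j : Fin (n + r)) :
    germOf (fun p => mulMap n r p j) (analyticAt_mulMap n r j) =
      (fGerm n r * gGerm n r).coeff j := by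
  let R := (Fin n ⊕ Fin r → ℂ) → ℂ
  let F : R[X] := monicOf fun i : Fin n => fun p => p (Sum.inl i)
  let G : R[X] := monicOf fun i : Fin r => fun p => p (Sum.inr i)
  let κ : R →+* Filter.Germ (𝓝 (0 : Fin n ⊕ Fin r → ℂ)) ℂ := Filter.Germ.coeRingHom _
  refine Subtype.ext ?_
  have h1 : (fun p => mulMap n r p j) = (F * G).coeff j := by
    funext p
    have hF : F.map (Pi.evalRingHom _ p) = fPoly n r p := map_monicOf _ _
    have hG : G.map (Pi.evalRingHom _ p) = gPoly n r p := map_monicOf _ _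
    rw [mulMap, ← hF, ← hG, ← Polynomial.map_mul, coeff_map]
    rfl
  have hF : F.map κ = (fGerm n r).map (germRing _).subtype := by
    rw [map_monicOf, fGerm, map_monicOf]
    rfl
  have hG : G.map κ = (gGerm n r).map (germRing _).subtype := by
    rw [map_monicOf, gGerm, map_monicOf]
    rfl
  change κ (fun p => mulMap n r p j) = (germRing _).subtype _
  rw [h1, ← coeff_map, Polynomial.map_mul, hF, hG, ← Polynomial.map_mul, coeff_map]

theorem monic_gGerm : (gGerm n r).Monic := monic_monicOf _

theorem natDegree_gGerm : (gGerm n r).natDegree = r := natDegree_monicOf _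

theorem mulIdeal_eq_chain : mulIdeal n r = chain (n + r) (gGerm n r) (fGerm n r) 0 := by
  have : digitSet (gGerm n r) (fGerm n r) 0 = ∅ := by simp [digitSet]
  simp only [mulIdeal, chain, this, Set.union_empty, germOf_mulMap]

/-! ### Critical extensions and the Thom–Boardman symbol -/

theorem upperExt_chain (hr : 1 ≤ r) (hrn : r ≤ n) (s : ℕ) :
    upperExt r (chain (n + r) (gGerm n r) (fGerm n r) s) =
      chain (n + r) (gGerm n r) (fGerm n r) (s + 1) := by
  have h : Fintype.card (Fin n ⊕ Fin r) + 1 - r = n + 1 := by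
    rw [Fintype.card_sum, Fintype.card_fin, Fintype.card_fin]
    omega
  rw [upperExt, h, jacobianExt_eq]
  exact jacExt_chain coord pder pderiv_coord hr hrn isUnit_natCast_succ s

theorem iterate_upperExt_mulIdeal (hr : 1 ≤ r) (hrn : r ≤ n) (s : ℕ) :
    (upperExt r)^[s] (mulIdeal n r) = chain (n + r) (gGerm n r) (fGerm n r) s := by
  induction s with
  | zero => exact mulIdeal_eq_chain n r
  | succ s ih => rw [Function.iterate_succ_apply', ih, upperExt_chain n r hr hrn]

theorem chain_germ_ne_top {s : ℕ} (hs : s * r ≤ n) :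
    chain (n + r) (gGerm n r) (fGerm n r) s ≠ ⊤ :=
  chain_ne_top coord valueHom valueHom_coord hs

theorem jacobianExt_chain_eq_top (s : ℕ) :
    jacobianExt n (chain (n + r) (gGerm n r) (fGerm n r) s) = ⊤ :=
  jacExt_chain_eq_top coord pder pderiv_coord s

theorem isCritical_chain (hr : 1 ≤ r) (hrn : r ≤ n) {s : ℕ} (hs : (s + 1) * r ≤ n) :
    IsCritical r (chain (n + r) (gGerm n r) (fGerm n r) s) := by
  have h : Fintype.card (Fin n ⊕ Fin r) = n + r := by simp
  refine ⟨by omega, ?_, ?_⟩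
  · rw [upperExt_chain n r hr hrn]
    exact chain_germ_ne_top n r hs
  · rw [h, Nat.add_sub_cancel]
    exact jacobianExt_chain_eq_top n r s

theorem criticalOrder_chain (hr : 1 ≤ r) (hrn : r ≤ n) {s : ℕ} (hs : (s + 1) * r ≤ n) :
    criticalOrder (chain (n + r) (gGerm n r) (fGerm n r) s) = n + 1 := by
  have h : Fintype.card (Fin n ⊕ Fin r) + 1 - r = n + 1 := by
    rw [Fintype.card_sum, Fintype.card_fin, Fintype.card_fin]
    omega
  refine criticalOrder_eq (jacobianExt_chain_eq_top n r s) ?_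
  have := (isCritical_chain n r hr hrn hs).2.1
  rwa [upperExt, h] at this

theorem iterate_criticalExt_mulIdeal (hr : 1 ≤ r) (hrn : r ≤ n) {s : ℕ} (hs : s * r ≤ n) :
    criticalExt^[s] (mulIdeal n r) = chain (n + r) (gGerm n r) (fGerm n r) s := by
  induction s with
  | zero => exact mulIdeal_eq_chain n r
  | succ s ih =>
    rw [Function.iterate_succ_apply', ih ((Nat.mul_le_mul_right r (Nat.le_succ s)).trans hs),
      criticalExt, criticalOrder_chain n r hr hrn hs, jacobianExt_eq]
    exact jacExt_chain coord pder pderiv_coord hr hrn isUnit_natCast_succ s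

theorem thomBoardman_mulIdeal (hr : 1 ≤ r) (hrn : r ≤ n) {s : ℕ} (hs : (s + 1) * r ≤ n) :
    thomBoardman (mulIdeal n r) s = r := by
  rw [thomBoardman, iterate_criticalExt_mulIdeal n r hr hrn
    ((Nat.mul_le_mul_right r (Nat.le_succ s)).trans hs), criticalOrder_chain n r hr hrn hs,
    Fintype.card_sum, Fintype.card_fin, Fintype.card_fin]
  omega

/-! ### The sequence `ψ` as residues -/

theorem aGerm_eq_coeff {i : ℕ} (hi : i < n) : aGerm n r i = (fGerm n r).coeff i := by
  rw [aGerm, dif_pos hi, fGerm, coeff_monicOf, dif_pos hi]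
  rfl

theorem bGerm_eq_coeff {i : ℕ} (hi : i < r) : bGerm n r i = (gGerm n r).coeff i := by
  rw [bGerm, dif_pos hi, gGerm, coeff_monicOf, dif_pos hi]
  rfl

theorem dRev_eq_coeff {j : ℕ} (hj : 1 ≤ j) (hjn : j ≤ n) :
    dRev n r j = ((X ^ r * fGerm n r) /ₘ gGerm n r).coeff (n - j) := by
  induction j using Nat.strong_induction_on with
  | _ j ih =>
  rw [dRev, coeff_divByMonic_rec (monic_gGerm n r) (natDegree_gGerm n r) (F := fGerm n r)
    (natDegree_monicOf _) (monic_monicOf _) hj hjn, aGerm_eq_coeff n r (by omega), Finset.sum_range]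
  congr 1
  · congr 1
    split_ifs with h
    · exact bGerm_eq_coeff n r (by omega)
    · rfl
  · refine Finset.sum_congr rfl fun i _ => ?_
    split_ifs with h
    · rw [ih i i.2 h.1 (by omega), bGerm_eq_coeff n r (by omega)]
    · rfl

theorem d_eq_res (hrn : r ≤ n) {i : ℕ} (hi : i < r) :
    d n r i = res (gGerm n r) 1 (fGerm n r * X ^ (r - 1 - i)) := by
  have hd := natDegree_gGerm n r
  rw [d, dRev_eq_coeff n r (by omega) (by omega), show n - (n - i) = i by omega,
    ← coeff_X_pow_mul_divByMonic (monic_gGerm n r) (by omega) i]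
  congr 2
  rw [mul_left_comm, ← pow_add, show i + 1 + (r - 1 - i) = r by omega, mul_comm]

theorem pderivB_res {j : ℕ} (hj : j < r) (s k : ℕ) :
    pderivB n r j (res (gGerm n r) (s + 1) (fGerm n r * X ^ k)) =
      - ((s + 1 : ℕ) : germRing (Fin n ⊕ Fin r)) *
        res (gGerm n r) (s + 2) (fGerm n r * X ^ (k + j)) := by
  have hd := natDegree_gGerm n r
  rw [pderivB, dif_pos hj, ← pder_apply, der_res _ (monic_gGerm n r) (by omega),
    Derivation.leibniz, Derivation.leibniz_pow]
  have hX : coeffDer (pder (Sum.inr ⟨j, hj⟩)) (X : (germRing (Fin n ⊕ Fin r))[X]) = 0 := by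
    ext i
    rw [coeff_coeffDer, coeff_X]
    split_ifs <;> simp
  rw [hX, fGerm, gGerm, coeffDer_inr_monicOf_inl coord pder pderiv_coord,
    coeffDer_inr_monicOf_inr coord pder pderiv_coord, pow_add]
  simp only [smul_zero, smul_eq_mul, mul_zero, map_zero, zero_sub, add_zero, neg_mul,
    mul_assoc]

theorem pderivB_zsmul {j : ℕ} (hj : j < r) (c : ℤ) (φ : germRing (Fin n ⊕ Fin r)) :
    pderivB n r j (c • φ) = c • pderivB n r j φ := by
  rw [pderivB, dif_pos hj, pderivB, dif_pos hj]
  exact map_zsmul (pder (Sum.inr ⟨j, hj⟩)) c φ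

/-- Since ∂g/∂b_j = x^j, the derivative in b_j inserts x^j, while each ∂/∂b_0 only raises the power
of g; the exponents accumulate to the signed factorial. -/
theorem iterate_pderivB_res (hr : 1 ≤ r) {j : ℕ} (hj : j < r) (t : ℕ) :
    (pderivB n r 0)^[t] (pderivB n r j (res (gGerm n r) 1 (fGerm n r))) =
      ((-1) ^ (t + 1) * ((t + 1).factorial : ℤ)) •
        res (gGerm n r) (t + 2) (fGerm n r * X ^ j) := by
  induction t with
  | zero =>
    have := pderivB_res n r hj 0 0
    rw [pow_zero, mul_one, zero_add, zero_add, zero_add] at this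
    rw [Function.iterate_zero, id, this]
    simp
  | succ t ih =>
    rw [Function.iterate_succ_apply', ih, pderivB_zsmul n r hr, pderivB_res n r hr, add_zero,
      Nat.factorial_succ (t + 1), zsmul_eq_mul, zsmul_eq_mul]
    push_cast
    ring

theorem isUnit_factorial_sign (t : ℕ) :
    IsUnit (((-1) ^ t * (t.factorial : ℤ) : ℤ) : germRing (Fin n ⊕ Fin r)) := by
  obtain ⟨k, hk⟩ := Nat.exists_eq_succ_of_ne_zero t.factorial_ne_zero
  rw [Int.cast_mul, Int.cast_pow, Int.cast_neg, Int.cast_one, Int.cast_natCast, hk]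
  exact (isUnit_one.neg.pow t).mul (isUnit_natCast_succ k)

theorem psi_eq_smul_res (hr : 1 ≤ r) (hrn : r ≤ n) {i : ℕ} (hi : i < r) (t : ℕ) :
    psi n r (t * r + i) = ((-1) ^ t * (t.factorial : ℤ)) •
      res (gGerm n r) (t + 1) (fGerm n r * X ^ (r - 1 - i)) := by
  rcases t with _ | t
  · rw [psi, zero_mul, zero_add, if_pos hi, d_eq_res n r hrn hi]
    simp
  · have hlt : ¬ (t + 1) * r + i < r := by
      rw [add_mul]
      omega
    have hdiv : ((t + 1) * r + i) / r = t + 1 := by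
      rw [mul_comm, Nat.mul_add_div (by omega), Nat.div_eq_of_lt hi, add_zero]
    have hmod : ((t + 1) * r + i) % r = i := by
      rw [mul_comm, Nat.mul_add_mod, Nat.mod_eq_of_lt hi]
    have hd : d n r (r - 1) = res (gGerm n r) 1 (fGerm n r) := by
      rw [d_eq_res n r hrn (by omega), Nat.sub_self, pow_zero, mul_one]
    rw [psi, if_neg hlt, hdiv, hmod, hd, Nat.add_sub_cancel,
      iterate_pderivB_res n r hr (by omega)]

theorem psi_mem_iff (hr : 1 ≤ r) (hrn : r ≤ n) {i : ℕ} (hi : i < r) (t : ℕ)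
    (K : Ideal (germRing (Fin n ⊕ Fin r))) : psi n r (t * r + i) ∈ K ↔
      res (gGerm n r) (t + 1) (fGerm n r * X ^ (r - 1 - i)) ∈ K := by
  rw [psi_eq_smul_res n r hr hrn hi, zsmul_eq_mul,
    Ideal.unit_mul_mem_iff_mem _ (isUnit_factorial_sign n r t)]

/-- An ideal contains the first `s * r` members of `ψ` if and only if it contains the coefficients of
the first `s` digits. -/
theorem psi_mem_iff_digit_mem (hr : 1 ≤ r) (hrn : r ≤ n) (s : ℕ)
    (K : Ideal (germRing (Fin n ⊕ Fin r))) : (∀ l < s * r, psi n r l ∈ K) ↔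
      ∀ t < s, digit (gGerm n r) (fGerm n r) t ∈ K.map C := by
  have hd := natDegree_gGerm n r
  rw [digits_mem_iff (monic_gGerm n r) (by omega), hd]
  constructor
  · intro h t ht i hi
    have := (psi_mem_iff n r hr hrn (i := r - 1 - i) (by omega) t K).1 (h _ ?_)
    · rwa [show r - 1 - (r - 1 - i) = i by omega] at this
    · have := Nat.mul_le_mul_right r (Nat.succ_le_of_lt ht)
      rw [Nat.succ_mul] at this
      omega
  · intro h l hl
    have hm : l % r < r := Nat.mod_lt _ hr
    have := (psi_mem_iff n r hr hrn hm (l / r) K).2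
      (h _ ((Nat.div_lt_iff_lt_mul hr).2 hl) _ (by omega))
    rwa [mul_comm, Nat.div_add_mod] at this

theorem chain_eq_sup_psi (hr : 1 ≤ r) (hrn : r ≤ n) (s : ℕ) :
    chain (n + r) (gGerm n r) (fGerm n r) s =
      mulIdeal n r ⊔ Ideal.span {φ | ∃ l : ℕ, l < s * r ∧ φ = psi n r l} := by
  -- Comparing the ideals `K` that contain each side reduces equality to `psi_mem_iff_digit_mem`.
  refine eq_of_forall_ge_iff fun K => ?_
  rw [sup_le_iff, mulIdeal_eq_chain, chain_le_iff, chain_le_iff, Ideal.span_le,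
    ← psi_mem_iff_digit_mem n r hr hrn]
  have : ({φ | ∃ l : ℕ, l < s * r ∧ φ = psi n r l} ⊆ (K : Set (germRing (Fin n ⊕ Fin r)))) ↔
      ∀ l < s * r, psi n r l ∈ K :=
    ⟨fun h l hl => h ⟨l, hl, rfl⟩, by
      rintro h _ ⟨l, hl, rfl⟩
      exact h l hl⟩
  rw [this]
  simp

end Multiplication

end ThomBoardman

theorem theorem3p6 (n r q₁ r₁ : ℕ) (hr : 1 ≤ r) (hrn : r ≤ n)
    (hdiv : n = q₁ * r + r₁) (hr₁ : r₁ < r) :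
    (∀ s : ℕ, 1 ≤ s → s ≤ q₁ →
      (ThomBoardman.upperExt r)^[s] (ThomBoardman.mulIdeal n r) =
        ThomBoardman.mulIdeal n r ⊔
          Ideal.span {φ | ∃ l : ℕ, l < s * r ∧ φ = ThomBoardman.psi n r l}) ∧
    (∀ s : ℕ, s < q₁ → ThomBoardman.IsCritical r
      ((ThomBoardman.upperExt r)^[s] (ThomBoardman.mulIdeal n r))) ∧
    (∀ s : ℕ, s < q₁ → ThomBoardman.thomBoardman (ThomBoardman.mulIdeal n r) s = r) := by
  have hle : ∀ s, s < q₁ → (s + 1) * r ≤ n := fun s hs => by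
    rw [hdiv]
    exact (Nat.mul_le_mul_right r hs).trans (Nat.le_add_right _ _)
  refine ⟨fun s _ _ => ?_, fun s hs => ?_, fun s hs => ?_⟩
  · rw [ThomBoardman.iterate_upperExt_mulIdeal n r hr hrn, ThomBoardman.chain_eq_sup_psi n r hr hrn]
  · rw [ThomBoardman.iterate_upperExt_mulIdeal n r hr hrn]
    exact ThomBoardman.isCritical_chain n r hr hrn (hle s hs)
  · exact ThomBoardman.thomBoardman_mulIdeal n r hr hrn (hle s hs)
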